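/- Let $F$ be a non-archimedean local field with residue field of order $q$ and odd residue characteristic $p$, and let $|\cdot|$ be its absolute value normalized by $|s|=q^{-v(s)}$. Let $\mathcal P$ be the topological closure of the prime ring of $F$ (so $\mathcal P\cong\mathbb Z/p\mathbb Z$ if $\operatorname{char}F=p$, and $\mathcal P\cong\mathbb Z_p$ if $\operatorname{char}F=0$). Let $\lambda$ be a non-trivial continuous unitary character of the additive group of $F$; for $s\in F$ put $\lambda[s](t)=\lambda(st)$. Let $\mathbb Q(\lambda)\subset\mathbb C$ be the field generated by the values of $\lambda$, and let $E=\mathbb Q(\lambda)(\sqrt{-1})$, which contains $\sqrt q$. The values of $\lambda$ are $p$-power roots of unity, and for $s\in\mathcal P^*$ let $\sigma_s\in\mathrm{Gal}(\mathbb Q(\lambda)/\mathbb Q)$ be the automorphism such that $\sigma_s(\zeta)=\zeta^r$ whenever $\zeta\in\operatorname{im}\lambda$, $\zeta^{p^n}=1$, $r\in\mathbb Z$ and $s\equiv r \bmod p^n\mathcal P$. Let $V$ be a finite-dimensional $F$-vector space with a non-degenerate alternating form $\langle\ ,\ \rangle$, let $V=X+Y$ with $X,Y$ maximal totally isotropic,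 let $x_1,\dots,x_n$ be a basis of $X$ and $y_1,\dots,y_n$ the basis of $Y$ with $\langle x_i,y_j\rangle=\delta_{ij}$. Linear maps act on the right. Let $P\subset \mathrm{Sp}(V)$ be the subgroup leaving $Y$ invariant. For $0\le i\le n$ let $\tau_i\in\mathrm{Sp}(V)$ send $x_j\mapsto -y_j$, $y_j\mapsto x_j$ for $j\le i$ and fix $x_j,y_j$ for $j>i$. For $g=\begin{pmatrix}a&b\\c&d\end{pmatrix}\in\mathrm{Sp}(V)$ (blocks with respect to $V=X+Y$, with $c:Y\to X$) let $Y_g=Y/\ker c$, and let $\mu_{\lambda,g}$ be the Haar measure on $Y_g$ defined as follows. The space $Y_{\tau_i}$ is identified with the span of $y_1,\dots,y_i$ and $\mu_{\lambda,\tau_i}=\prod_{k\le i}d_\lambda y_k$, where $d_\lambda t$ is the Haar measure on $F$ that is self-dual with respect to $\lambda$. If $i=\dim Y_g$ and $g=p_1\tau_ip_2$ with $p_1,p_2\in P$ (such $p_1,p_2$ exist, and the result does not depend on them), then $\mu_{\lambda,g}=|\det(p_1p_2|_Y)|^{-1/2}$ times the pullback of $\mu_{\lambda,\tau_i}$ along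 the isomorphism $Y_g\to Y_{\tau_i}$ induced by $p_1$. The Weil operator $W_\lambda(g)$ is defined for locally constant compactly supported $\phi:X\to\mathbb C$ by $$[W_\lambda(g)\phi](x)=\int_{Y_g}\lambda\left(\frac{\langle xa,xb\rangle-2\langle xb,yc\rangle+\langle yc,yd\rangle}{2}\right)\phi(xa+yc)\,d\mu_{\lambda,g}y .$$ For a subfield $L$ of $\mathbb C$ let $\mathcal S(X,L)$ be the space of locally constant compactly supported functions $X\to L$. For $\sigma\in\mathrm{Gal}(E/\mathbb Q)$ let $(\sigma\phi)(x)=\sigma(\phi(x))$ for $\phi\in\mathcal S(X,E)$, and ${}^\sigma T(\phi)=\sigma[T(\sigma^{-1}\phi)]$ for $T\in\operatorname{End}\mathcal S(X,E)$. Let $\sigma\in\mathrm{Gal}(E/\mathbb Q(\sqrt q))$ with $\sigma|_{\mathbb Q(\lambda)}=\sigma_s$, where $s\in\mathcal P^*$. Then for every $g\in\mathrm{Sp}(V)$ the operators $W_\lambda(g)$ and $W_{\lambda[s]}(g)$ restrict to $E$-linear endomorphisms of $\mathcal S(X,E)$, and on $\mathcal S(X,E)$ $${}^\sigma W_\lambda(g)=W_{\lambda[s]}(g).$$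 -/

import Mathlib

open MeasureTheory ValuativeRel

noncomputable section

namespace LocalWeil

/-! ### The local field -/

section LocalField

variable (F : Type*) [Field F] [ValuativeRel F] [TopologicalSpace F]
  [IsNonarchimedeanLocalField F]

/-- The order `q` of the residue class field. -/
def resCard : ℕ := Nat.card 𝓀[F]

/-- The residue characteristic `p`. -/
def resChar : ℕ := ringChar 𝓀[F]

variable {F} in
open Classical in
/-- The normalized absolute value `|s| = q ^ (-v s)`, `|0| = 0`. The value group (written
multiplicatively, with zero) is identified with `ℤᵐ⁰` as an ordered group, so that the logarithm
of the valuation of `s` is `-v s`. -/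
def absF (s : F) : ℝ :=
  if s = 0 then 0
  else (resCard F : ℝ) ^
    WithZero.log (IsNonarchimedeanLocalField.valueGroupWithZeroIsoInt F (valuation F s))

/-- `𝒫`: the topological closure of the prime ring of `F`. -/
def primeClosure : Subring F := (⊥ : Subring F).topologicalClosure

end LocalField

/-! ### Bruhat-Schwartz functions -/

/-- `𝒮(A, K)`: locally constant functions `A → K` of compact support. -/
def schwartz (A K : Type*) [TopologicalSpace A] [Field K] : Submodule K (A → K) where
  carrier := {f | IsLocallyConstant f ∧ HasCompactSupport f}
  add_mem' hf hg := ⟨hf.1.add hg.1, hf.2.add hg.2⟩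
  zero_mem' := ⟨IsLocallyConstant.const 0, HasCompactSupport.zero⟩
  smul_mem' c _ hf := ⟨hf.1.comp (fun z => c • z), hf.2.comp_left (g := fun z => c • z) (smul_zero c)⟩

/-- The Galois action on functions: `(σ φ)(x) = σ (φ x)`. -/
def galAct {A K : Type*} [TopologicalSpace A] [Field K] [Algebra ℚ K] (σ : K ≃ₐ[ℚ] K)
    (φ : schwartz A K) : schwartz A K :=
  ⟨fun x => σ (φ.1 x), φ.2.1.comp σ, φ.2.2.comp_left (map_zero σ)⟩

/-- The Galois action on operators: `(σ T)(φ) = σ (T (σ⁻¹ φ))`. -/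
def galConj {A K : Type*} [TopologicalSpace A] [Field K] [Algebra ℚ K] (σ : K ≃ₐ[ℚ] K)
    (T : Module.End K (schwartz A K)) : Module.End K (schwartz A K) where
  toFun φ := galAct σ (T (galAct σ.symm φ))
  map_add' φ ψ := by
    have h : galAct σ.symm (φ + ψ) = galAct σ.symm φ + galAct σ.symm ψ := by
      ext x; simp [galAct]
    rw [h, map_add]
    ext x; simp [galAct]
  map_smul' c φ := by
    have h : galAct σ.symm (c • φ) = σ.symm c • galAct σ.symm φ := by
      ext x; simp [galAct]
    rw [h, map_smul]
    ext x; simp [galAct]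

/-- The complex-valued function underlying a function with values in a subfield of `ℂ`. -/
def toComplex {A : Type*} [TopologicalSpace A] {L : IntermediateField ℚ ℂ}
    (φ : schwartz A L) : A → ℂ := fun x => (φ.1 x : ℂ)

/-! ### Characters -/

section Character

variable {F : Type*} [Field F]

/-- `ℚ(lam)`: the field generated by the values of the unitary character `lam` of `F`. -/
def charField (lam : AddChar F Circle) : IntermediateField ℚ ℂ :=
  IntermediateField.adjoin ℚ (Set.range fun x => (lam x : ℂ))

theorem coe_mem_charField (lam : AddChar F Circle) (x : F) : (lam x : ℂ) ∈ charField lam :=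
  IntermediateField.subset_adjoin _ _ ⟨x, rfl⟩

/-- `E = ℚ(lam)(√-1)`. -/
def fieldE (lam : AddChar F Circle) : IntermediateField ℚ ℂ :=
  charField lam ⊔ IntermediateField.adjoin ℚ {Complex.I}

theorem charField_le_fieldE (lam : AddChar F Circle) : charField lam ≤ fieldE lam :=
  le_sup_left

/-- `lam[s]`: the character `t ↦ lam (s * t)`. -/
def rescale (lam : AddChar F Circle) (s : F) : AddChar F Circle := lam.mulShift s

variable [ValuativeRel F] [TopologicalSpace F] [IsNonarchimedeanLocalField F]

/-- `τ = σ_s`: the automorphism `τ` of `ℚ(lam)` corresponds to the unit `s` of `𝒫` under the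
canonical isomorphism `Gal(ℚ(lam)/ℚ) ≃ Aut(im lam) ≃ 𝒫ˣ`. Here the image of `lam` is a group of
`p`-power roots of unity, and `s` acts on those of order dividing `p ^ n` by raising them to the
power `r`, for any integer `r` with `s ≡ r mod p ^ n 𝒫`. -/
def IsSigma (lam : AddChar F Circle) (s : (primeClosure F)ˣ)
    (τ : charField lam ≃ₐ[ℚ] charField lam) : Prop :=
  ∀ (n : ℕ) (r : ℤ),
    (∃ t : primeClosure F, (s : primeClosure F) =
      (r : primeClosure F) + (resChar F : primeClosure F) ^ n * t) →
    ∀ x : F, lam x ^ (resChar F ^ n) = 1 →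
      τ ⟨(lam x : ℂ), coe_mem_charField lam x⟩ =
        (⟨(lam x : ℂ), coe_mem_charField lam x⟩ : charField lam) ^ r

variable [MeasurableSpace F]

/-- The Fourier transform `s ↦ ∫ lam[s](t) φ(t) dt` for the measure `m = dt`. -/
def fourier (lam : AddChar F Circle) (m : Measure F) (φ : F → ℂ) (s : F) : ℂ :=
  ∫ t, (rescale lam s t : ℂ) * φ t ∂m

/-- The Haar measure `m` is self-dual for `lam`: Fourier inversion holds with constant `1`. -/
def IsSelfDual (lam : AddChar F Circle) (m : Measure F) : Prop :=
  m.IsAddHaarMeasure ∧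
    ∀ φ ∈ schwartz F ℂ, ∀ t, fourier lam m (fourier lam m φ) t = φ (-t)

open Classical in
/-- `d_lam t`: the unique self-dual Haar measure on `F` associated with the non-trivial continuous
character `lam`. -/
def selfDual (lam : AddChar F Circle) : Measure F :=
  if h : ∃ m, IsSelfDual lam m then h.choose else 0

end Character

/-! ### Symplectic spaces -/

/-- A symplectic `F`-vector space `V` (with form `form`), a decomposition `V = X + Y` into maximal
totally isotropic subspaces, a basis `x` of `X` and the dual basis `y` of `Y`. -/
structure Polarization (F V : Type*) [Field F] [AddCommGroup V] [Module F V] where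
  form : LinearMap.BilinForm F V
  alt : form.IsAlt
  nondegenerate : form.Nondegenerate
  X : Submodule F V
  Y : Submodule F V
  isCompl : IsCompl X Y
  isotropic_X : ∀ v ∈ X, ∀ w ∈ X, form v w = 0
  isotropic_Y : ∀ v ∈ Y, ∀ w ∈ Y, form v w = 0
  n : ℕ
  x : Module.Basis (Fin n) F X
  y : Module.Basis (Fin n) F Y
  dual : ∀ i j, form (x i) (y j) = if i = j then 1 else 0

namespace Polarization

variable {F V : Type*} [Field F] [AddCommGroup V] [Module F V] (D : Polarization F V)

/-- The symplectic group `Sp(V)`. Linear maps of `V` act on the right on row vectors: `v g` is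
`g v` here, so that a product `g h` read from left to right is `h ∘ g`. -/
def Sp : Subgroup (V ≃ₗ[F] V) where
  carrier := {g | ∀ v w, D.form (g v) (g w) = D.form v w}
  mul_mem' {g h} hg hh v w := by
    rw [LinearEquiv.mul_apply, LinearEquiv.mul_apply, hg, hh]
  one_mem' _ _ := rfl
  inv_mem' {g} hg v w := by
    have h := hg (g⁻¹ v) (g⁻¹ w)
    rw [← LinearEquiv.mul_apply, ← LinearEquiv.mul_apply, mul_inv_cancel] at h
    exact h.symm

/-- The parabolic subgroup `P` of the elements of `Sp(V)` that leave `Y` invariant. -/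
def P : Set (V ≃ₗ[F] V) := {g | g ∈ D.Sp ∧ D.Y.map (g : V →ₗ[F] V) = D.Y}

/-- The projection of `V = X + Y` on `X`. -/
def prX : V →ₗ[F] D.X := D.X.projectionOnto D.Y D.isCompl

/-- The projection of `V = X + Y` on `Y`. -/
def prY : V →ₗ[F] D.Y := D.Y.projectionOnto D.X D.isCompl.symm

/-- The block `a : X → X` of a linear map. -/
def a (g : V →ₗ[F] V) : D.X →ₗ[F] D.X := D.prX ∘ₗ g ∘ₗ D.X.subtype

/-- The block `b : X → Y` of a linear map. -/
def b (g : V →ₗ[F] V) : D.X →ₗ[F] D.Y := D.prY ∘ₗ g ∘ₗ D.X.subtype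

/-- The block `c : Y → X` of a linear map. -/
def c (g : V →ₗ[F] V) : D.Y →ₗ[F] D.X := D.prX ∘ₗ g ∘ₗ D.Y.subtype

/-- The block `d : Y → Y` of a linear map. If `g` maps `Y` to `Y`, this is the restriction of `g`
to `Y`. -/
def d (g : V →ₗ[F] V) : D.Y →ₗ[F] D.Y := D.prY ∘ₗ g ∘ₗ D.Y.subtype

theorem prX_add_prY (v : V) : (D.prX v : V) + (D.prY v : V) = v := by
  obtain ⟨a, b, rfl, _⟩ := Submodule.existsUnique_add_of_isCompl D.isCompl v
  simp [prX, prY]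

theorem prX_eq_zero_iff (v : V) : D.prX v = 0 ↔ v ∈ D.Y :=
  Submodule.projectionOnto_apply_eq_zero_iff D.isCompl

/-- `Y_g = Y / ker c`. -/
abbrev YQuot (g : V →ₗ[F] V) : Type _ := D.Y ⧸ LinearMap.ker (D.c g)

/-- `Y_g` carries its Borel sets. -/
instance [TopologicalSpace V] (g : V →ₗ[F] V) : MeasurableSpace (D.YQuot g) := borel _

/-- The basis `x_1, …, x_n, y_1, …, y_n` of `V`. -/
def basis : Module.Basis (Fin D.n ⊕ Fin D.n) F V :=
  (D.x.prod D.y).map (Submodule.prodEquivOfIsCompl D.X D.Y D.isCompl)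

/-- The map `τ_i`: it sends `x_j` to `-y_j` and `y_j` to `x_j` for the first `i` indices `j`, and
fixes the other basis vectors. -/
def tau (i : ℕ) : V →ₗ[F] V :=
  D.basis.constr F (Sum.elim
    (fun j => if (j : ℕ) < i then -(D.y j : V) else (D.x j : V))
    (fun j => if (j : ℕ) < i then (D.x j : V) else (D.y j : V)))

/-- `g = p₁ τ_i p₂` with `p₁, p₂ ∈ P` and `i = dim Y_g`. -/
def IsFactorization (g p₁ p₂ : V ≃ₗ[F] V) : Prop :=
  p₁ ∈ D.P ∧ p₂ ∈ D.P ∧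
    (g : V →ₗ[F] V) =
      (p₂ : V →ₗ[F] V) ∘ₗ D.tau (Module.finrank F (D.YQuot (g : V →ₗ[F] V))) ∘ₗ (p₁ : V →ₗ[F] V)

variable {D} in
theorem IsFactorization.ker_le {g p₁ p₂ : V ≃ₗ[F] V} (h : D.IsFactorization g p₁ p₂) :
    LinearMap.ker (D.c (g : V →ₗ[F] V)) ≤
      (LinearMap.ker (D.c (D.tau (Module.finrank F (D.YQuot (g : V →ₗ[F] V)))))).comap
        (D.d (p₁ : V →ₗ[F] V)) := by
  obtain ⟨h₁, h₂, hg⟩ := h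
  generalize D.tau (Module.finrank F (D.YQuot (g : V →ₗ[F] V))) = T at hg ⊢
  intro y hy
  have hy' : g y ∈ D.Y := (D.prX_eq_zero_iff _).1 hy
  have h1 : ((D.d (p₁ : V →ₗ[F] V) y : D.Y) : V) = p₁ y := by
    have hm : p₁ (y : V) ∈ D.Y := by
      have h0 : (p₁ : V →ₗ[F] V) (y : V) ∈ D.Y.map (p₁ : V →ₗ[F] V) := ⟨y, y.2, rfl⟩
      rw [h₁.2] at h0
      exact h0
    have h3 := D.prX_add_prY (p₁ (y : V))
    rw [(D.prX_eq_zero_iff _).2 hm] at h3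
    rw [Submodule.coe_zero, zero_add] at h3
    exact h3
  change D.prX (T ((D.d (p₁ : V →ₗ[F] V) y : D.Y) : V)) = 0
  rw [h1, D.prX_eq_zero_iff]
  have h4 : g y = p₂ (T (p₁ y)) := congrArg (fun f : V →ₗ[F] V => f y) hg
  have h6 : g y ∈ D.Y.map (p₂ : V →ₗ[F] V) := by rw [h₂.2]; exact hy'
  rw [h4] at h6
  obtain ⟨z, hz, hzz⟩ := h6
  have h5 : z = T (p₁ y) := p₂.injective hzz
  exact h5 ▸ hz

/-- The isomorphism `Y_g → Y_{τ_i}` induced by `p₁`, where `g = p₁ τ_i p₂`. -/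
def pBar {g p₁ p₂ : V ≃ₗ[F] V} (h : D.IsFactorization g p₁ p₂) :
    D.YQuot (g : V →ₗ[F] V) →ₗ[F]
      D.YQuot (D.tau (Module.finrank F (D.YQuot (g : V →ₗ[F] V)))) :=
  Submodule.mapQ _ _ (D.d (p₁ : V →ₗ[F] V)) h.ker_le

/-- The integrand of the Weil operator, as a function of `y ∈ Y`. -/
def integrand (lam : AddChar F Circle) (g : V ≃ₗ[F] V) (φ : D.X → ℂ) (x : D.X) (y : D.Y) : ℂ :=
  (lam ((D.form (D.a (g : V →ₗ[F] V) x) (D.b (g : V →ₗ[F] V) x)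
      - 2 * D.form (D.b (g : V →ₗ[F] V) x) (D.c (g : V →ₗ[F] V) y)
      + D.form (D.c (g : V →ₗ[F] V) y) (D.d (g : V →ₗ[F] V) y)) / 2) : ℂ) *
    φ (D.a (g : V →ₗ[F] V) x + D.c (g : V →ₗ[F] V) y)

/-- The integrand is constant on the cosets of `ker c`. -/
theorem integrand_congr (lam : AddChar F Circle) (g : D.Sp) (φ : D.X → ℂ) (x : D.X) (y y' : D.Y)
    (h : (LinearMap.ker (D.c (g.1 : V →ₗ[F] V))).quotientRel y y') :
    D.integrand lam g.1 φ x y = D.integrand lam g.1 φ x y' := by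
  have hk : y - y' ∈ LinearMap.ker (D.c (g.1 : V →ₗ[F] V)) := (Submodule.quotientRel_def _).1 h
  obtain ⟨k, rfl⟩ : ∃ k, y = y' + k := ⟨y - y', by abel⟩
  rw [add_sub_cancel_left, LinearMap.mem_ker] at hk
  have hc : D.c (g.1 : V →ₗ[F] V) (y' + k) = D.c (g.1 : V →ₗ[F] V) y' := by
    rw [map_add, hk, add_zero]
  have hdec : ∀ z : D.Y,
      g.1 (z : V) = (D.c (g.1 : V →ₗ[F] V) z : V) + (D.d (g.1 : V →ₗ[F] V) z : V) :=
    fun z => (D.prX_add_prY (g.1 (z : V))).symm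
  have h0 : D.form (D.c (g.1 : V →ₗ[F] V) y' : V) (D.d (g.1 : V →ₗ[F] V) k : V) = 0 := by
    have h1 := g.2 (y' : V) (k : V)
    rw [D.isotropic_Y _ y'.2 _ k.2, hdec, hdec, hk, Submodule.coe_zero, zero_add, map_add,
      LinearMap.add_apply, D.isotropic_Y _ (D.d (g.1 : V →ₗ[F] V) y').2 _
        (D.d (g.1 : V →ₗ[F] V) k).2, add_zero] at h1
    exact h1
  unfold integrand
  rw [hc, map_add (D.d (g.1 : V →ₗ[F] V)), Submodule.coe_add, map_add, h0, add_zero]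

variable [ValuativeRel F] [TopologicalSpace F] [IsNonarchimedeanLocalField F] [MeasurableSpace F]
  [TopologicalSpace V]

/-- The Haar measure `∏_{k ≤ i} d_lam y_k` on `Y_{τ_i}`, which is identified with the span of
`y_1, …, y_i`. -/
def muTau (lam : AddChar F Circle) (i : ℕ) : Measure (D.YQuot (D.tau i)) :=
  (Measure.pi fun _ : {k : Fin D.n // (k : ℕ) < i} => selfDual lam).map
    fun t => Submodule.Quotient.mk (∑ k, t k • D.y k.1)

open Classical in
/-- The Haar measure `μ_{lam,g}` on `Y_g`: if `g = p₁ τ_i p₂`, it is `|det (p₁ p₂ | Y)| ^ (-1/2)`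
times the pullback of `μ_{lam,τ_i}` along the isomorphism induced by `p₁`. It does not depend on
the factorization, which exists for every `g` in `Sp(V)`. -/
def mu (lam : AddChar F Circle) (g : V ≃ₗ[F] V) : Measure (D.YQuot (g : V →ₗ[F] V)) :=
  if h : ∃ p : (V ≃ₗ[F] V) × (V ≃ₗ[F] V), D.IsFactorization g p.1 p.2 then
    ENNReal.ofReal
        (absF (LinearMap.det
          (D.d ((h.choose.2 : V →ₗ[F] V) ∘ₗ (h.choose.1 : V →ₗ[F] V)))) ^ (-1 / 2 : ℝ)) •
      (muTau D lam (Module.finrank F (D.YQuot (g : V →ₗ[F] V)))).comap (D.pBar h.choose_spec)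
  else 0


/-- The Weil operator `W_lam(g)`, given by the integral over `Y_g` for the measure `μ_{lam,g}`. -/
def weil (lam : AddChar F Circle) (g : D.Sp) (φ : D.X → ℂ) (x : D.X) : ℂ :=
  ∫ z : D.YQuot (g.1 : V →ₗ[F] V),
    Quotient.lift (D.integrand lam g.1 φ x) (D.integrand_congr lam g φ x) z ∂(D.mu lam g.1)

end Polarization

end LocalWeil

end

set_option linter.unusedSectionVars false

noncomputable section

namespace LocalWeil

/-! ### Locally constant functions of compact support, and measures of compact open sets. -/

section General

open Topology

/-! For fixed `x`, the integrand of the Weil operator is a locally constant function `f` of compact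
support on `Y_g`. If `φ` has values in `E`, so has `f`, and the integral is the finite sum of
`μ(f⁻¹{v}) · v` over the nonzero values `v` of `f`. Everything rests on three facts about this sum.

The weights `μ(f⁻¹{v})` lie in `ℚ(√q)`, so `σ` fixes them (`mu_spec`, `integral_spec`). A compact
open subset of `F^I` is a finite union of cosets of a small `(c𝒪)^I`; the measure of `c𝒪` is an
integral power of `q` times that of `𝒪`; Fourier inversion for the indicator of `𝒪` shows that the
square of the self-dual measure of `𝒪` is a power of `q`; and the factor `|det|^(-1/2)` is an
integral power of `√q`. That `√q` lies in `E` follows from the quadratic Gauss sum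
(`sqrt_resCard_mem`).

The measure is the same for `λ` and `λ[s]`. A unit `s` of `𝒫` has absolute value `1`, so
multiplication by it preserves Haar measure and the two characters have the same self-dual measures
(`selfDual_rescale`, `mu_congr`).

Finally `σ(λ(u)) = λ(su)` (`IsSigma.apply_coe`). Hence `σ` carries the integrand for `λ` and `σ⁻¹φ`
to the integrand for `λ[s]` and `φ`, and applying `σ` to the finite sum gives the claim.

Two existence statements give the definitions content, since `selfDual` and `mu` are choices with
default value `0`: Fourier inversion (`fourier_fourier`) and the Bruhat decomposition
(`exists_isFactorization`). That the operators preserve Schwartz functions comes from the behaviour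
of the integrand under small translations in `X` and in `Y`. -/

theorem isLocallyConstant_comp {A B R : Type*} [TopologicalSpace A] [TopologicalSpace B]
    {f : B → R} (hf : IsLocallyConstant f) {g : A → B} (hg : Continuous g) :
    IsLocallyConstant fun x => f (g x) := fun s => (hf s).preimage hg

/-- A locally constant function of compact support is invariant under small translations. -/
theorem exists_nhds_forall_add_eq {G R : Type*} [TopologicalSpace G] [AddCommGroup G]
    [IsTopologicalAddGroup G] [Zero R] {f : G → R} (hf : IsLocallyConstant f)
    (hc : HasCompactSupport f) : ∃ N ∈ 𝓝 (0 : G), ∀ h ∈ N, ∀ x, f (x + h) = f x := by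
  have hopen : IsOpen {p : G × G | f (p.1 + p.2) = f p.1} := by
    have h1 : IsLocallyConstant fun p : G × G => (f (p.1 + p.2), f p.1) :=
      (isLocallyConstant_comp hf continuous_add).prodMk (isLocallyConstant_comp hf continuous_fst)
    exact h1 {q | q.1 = q.2}
  obtain ⟨U, V, -, hV, hU, h0, hUV⟩ := generalized_tube_lemma hc.isCompact
    (isCompact_singleton (x := (0 : G))) hopen (by rintro ⟨a, b⟩ ⟨-, rfl⟩; simp)
  have hV0 : V ∈ 𝓝 (0 : G) := hV.mem_nhds (h0 rfl)
  have hnV : -V ∈ 𝓝 (0 : G) := neg_mem_nhds_zero G hV0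
  -- The neighbourhood is made symmetric for the case where only `x + h` lies in the support: there
  -- one translates back by `-h`.
  refine ⟨V ∩ -V, Filter.inter_mem hV0 hnV, fun h hh x => ?_⟩
  by_cases hx : x ∈ tsupport f
  · exact hUV (Set.mk_mem_prod (hU hx) hh.1)
  · by_cases hxh : x + h ∈ tsupport f
    · have := hUV (Set.mk_mem_prod (hU hxh) hh.2)
      simpa using this.symm
    · rw [image_eq_zero_of_notMem_tsupport hx, image_eq_zero_of_notMem_tsupport hxh]

/-- The nonzero fibres of a locally constant function of compact support are compact open. -/
theorem isCompact_isOpen_fiber {A R : Type*} [TopologicalSpace A] [Zero R] {f : A → R}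
    (hf : IsLocallyConstant f) (hc : HasCompactSupport f) {v : R} (hv : v ≠ 0) :
    IsCompact (f ⁻¹' {v}) ∧ IsOpen (f ⁻¹' {v}) := by
  refine ⟨hc.isCompact.of_isClosed_subset (hf.isClosed_fiber v) ?_, hf.isOpen_fiber v⟩
  intro x hx
  apply subset_tsupport
  rw [Function.mem_support, show f x = v from hx]
  exact hv

theorem finite_range_of_hasCompactSupport {A R : Type*} [TopologicalSpace A] [Zero R] {f : A → R}
    (hf : IsLocallyConstant f) (hc : HasCompactSupport f) : (Set.range f).Finite := by
  let : TopologicalSpace R := ⊥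
  have : DiscreteTopology R := ⟨rfl⟩
  have h1 : (f '' tsupport f).Finite := (hc.isCompact.image hf.continuous).finite_of_discrete
  refine (h1.union (Set.finite_singleton 0)).subset ?_
  rintro _ ⟨x, rfl⟩
  by_cases hx : x ∈ tsupport f
  · exact Or.inl ⟨x, hx, rfl⟩
  · exact Or.inr (image_eq_zero_of_notMem_tsupport hx)

/-- The integral of a locally constant function of compact support with values in `R`, mapped to
`ℂ` in any way, is a finite sum over the nonzero values. -/
theorem integral_comp_eq_sum {A R : Type*} [TopologicalSpace A] [MeasurableSpace A]
    [OpensMeasurableSpace A] (μ : Measure A) (hμ : ∀ U, IsCompact U → IsOpen U → μ U ≠ ⊤)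
    [Zero R] {f : A → R} (hf : IsLocallyConstant f) (hc : HasCompactSupport f) :
    ∃ S : Finset R, (∀ v ∈ S, IsCompact (f ⁻¹' {v}) ∧ IsOpen (f ⁻¹' {v})) ∧
      ∀ ψ : R → ℂ, ψ 0 = 0 → Integrable (fun x => ψ (f x)) μ ∧
        ∫ x, ψ (f x) ∂μ = ∑ v ∈ S, (μ.real (f ⁻¹' {v}) : ℂ) * ψ v := by
  classical
  let S := (finite_range_of_hasCompactSupport hf hc).toFinset.erase 0
  have hS : ∀ v ∈ S, IsCompact (f ⁻¹' {v}) ∧ IsOpen (f ⁻¹' {v}) := fun v hv =>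
    isCompact_isOpen_fiber hf hc (Finset.ne_of_mem_erase hv)
  refine ⟨S, hS, fun ψ hψ => ?_⟩
  have hfun : (fun x => ψ (f x)) =
      fun x => ∑ v ∈ S, (f ⁻¹' {v}).indicator (fun _ => ψ v) x := by
    funext x
    by_cases hx : f x = 0
    · rw [hx, hψ]
      refine (Finset.sum_eq_zero fun v hv => Set.indicator_of_notMem ?_ _).symm
      intro h
      exact Finset.ne_of_mem_erase hv ((show f x = v from h).symm.trans hx)
    · rw [Finset.sum_eq_single (f x)]
      · exact (Set.indicator_of_mem (s := f ⁻¹' {f x}) rfl fun _ => ψ (f x)).symm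
      · intro v _ hv
        exact Set.indicator_of_notMem (fun h => hv (show f x = v from h).symm) _
      · intro h
        exact absurd (Finset.mem_erase.2 ⟨hx, by simp⟩) h
  have hint : ∀ v ∈ S, Integrable ((f ⁻¹' {v}).indicator fun _ => ψ v) μ := fun v hv =>
    (integrable_indicator_iff (hS v hv).2.measurableSet).2
      (integrableOn_const (hμ _ (hS v hv).1 (hS v hv).2))
  rw [hfun]
  refine ⟨integrable_finsetSum _ hint, ?_⟩
  rw [integral_finsetSum _ hint]
  refine Finset.sum_congr rfl fun v hv => ?_
  rw [integral_indicator_const _ (hS v hv).2.measurableSet]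
  simp

/-- The measure of a disjoint union of `card S` sets, each a translate of `H`. -/
theorem measure_iUnion_translates {G S : Type*} [AddGroup G] [MeasurableSpace G] [MeasurableAdd G]
    (μ : Measure G) [μ.IsAddLeftInvariant] [Fintype S] {H : Set G} (A : S → Set G)
    (hA : ∀ s, MeasurableSet (A s)) (hd : Pairwise fun s t => Disjoint (A s) (A t))
    (ht : ∀ s, ∃ g, A s = (fun x => g + x) ⁻¹' H) :
    μ (⋃ s, A s) = Fintype.card S * μ H := by
  rw [measure_iUnion hd hA, tsum_fintype]
  have : ∀ s, μ (A s) = μ H := fun s => by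
    obtain ⟨g, hg⟩ := ht s
    rw [hg, measure_preimage_add]
  simp [this]

/-- A compact set that is a union of cosets of an open subgroup `H` has as measure an integral
multiple of that of `H`. -/
theorem exists_measure_eq_natCast_mul {G : Type*} [AddCommGroup G] [TopologicalSpace G]
    [IsTopologicalAddGroup G] [MeasurableSpace G] [BorelSpace G]
    (μ : Measure G) [μ.IsAddLeftInvariant] (H : AddSubgroup G) (hH : IsOpen (H : Set G))
    {U : Set G} (hU : IsCompact U) (hUH : ∀ x ∈ U, ∀ h ∈ H, x + h ∈ U) :
    ∃ N : ℕ, μ U = N * μ H := by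
  have : DiscreteTopology (G ⧸ H) := QuotientAddGroup.discreteTopology hH
  have hfin : ((QuotientAddGroup.mk : G → G ⧸ H) '' U).Finite :=
    (hU.image QuotientAddGroup.continuous_mk).finite_of_discrete
  have := hfin.fintype
  let A : ((QuotientAddGroup.mk : G → G ⧸ H) '' U) → Set G :=
    fun s => (QuotientAddGroup.mk : G → G ⧸ H) ⁻¹' {s.1}
  refine ⟨Fintype.card ((QuotientAddGroup.mk : G → G ⧸ H) '' U), ?_⟩
  rw [← measure_iUnion_translates μ (H := (H : Set G)) A]
  · congr 1
    ext x
    simp only [A, Set.mem_iUnion, Set.mem_preimage, Set.mem_singleton_iff]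
    constructor
    · intro hx
      exact ⟨⟨_, x, hx, rfl⟩, rfl⟩
    · rintro ⟨⟨_, y, hy, rfl⟩, hxy⟩
      have : -y + x ∈ H := QuotientAddGroup.eq.1 hxy.symm
      simpa using hUH y hy _ this
  · intro s
    exact ((isOpen_discrete {s.1}).preimage QuotientAddGroup.continuous_mk).measurableSet
  · intro s t hst
    refine Set.disjoint_left.2 fun x hx hx' => hst (Subtype.ext ?_)
    exact (show (x : G ⧸ H) = s.1 from hx).symm.trans hx'
  · rintro ⟨_, y, hy, rfl⟩
    refine ⟨-y, ?_⟩
    ext x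
    simp only [A, Set.mem_preimage, Set.mem_singleton_iff, SetLike.mem_coe]
    rw [eq_comm, QuotientAddGroup.eq]

end General

end LocalWeil

end

noncomputable section

namespace LocalWeil

/-! ### Topology and lattices of the local field. -/

section LocalFieldTopology

open Topology Pointwise

variable (F : Type*) [Field F] [ValuativeRel F] [TopologicalSpace F]
  [IsNonarchimedeanLocalField F]

/-- The rank-one valuation makes `F` a locally compact normed field, hence a proper space. Second
countability lets Borel structures multiply, as needed for Fubini on `F × F` and for measures on
`F^I`. -/
instance secondCountableTopology : SecondCountableTopology F := by
  let := IsTopologicalAddGroup.rightUniformSpace F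
  have := isUniformAddGroup_of_addCommGroup (G := F)
  let : (Valued.v (R := F)).RankOne :=
    { hom' := IsRankLeOne.nonempty.some.emb (R := F).comp MonoidWithZeroHom.ValueGroup₀.embedding
      strictMono' := IsRankLeOne.nonempty.some.strictMono.comp
        MonoidWithZeroHom.ValueGroup₀.embedding_strictMono }
  open scoped Valued in
  have : ProperSpace F := .of_nontriviallyNormedField_of_weaklyLocallyCompactSpace F
  exact secondCountable_of_proper

instance t2Space : T2Space F := by
  let := IsTopologicalAddGroup.rightUniformSpace F
  have := isUniformAddGroup_of_addCommGroup (G := F)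
  let : (Valued.v (R := F)).RankOne :=
    { hom' := IsRankLeOne.nonempty.some.emb (R := F).comp MonoidWithZeroHom.ValueGroup₀.embedding
      strictMono' := IsRankLeOne.nonempty.some.strictMono.comp
        MonoidWithZeroHom.ValueGroup₀.embedding_strictMono }
  infer_instance
variable {F}

/-- The lattice `c 𝒪` in `F`. -/
def lattice (c : F) : AddSubgroup F where
  carrier := {x | valuation F x ≤ valuation F c}
  add_mem' hx hy := by
    rw [Set.mem_ofPred_eq] at *
    exact (valuation F).map_add_le hx hy
  zero_mem' := by simp
  neg_mem' := fun {x} hx => by simpa [Valuation.map_neg] using hx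

theorem mem_lattice {c x : F} : x ∈ lattice c ↔ valuation F x ≤ valuation F c :=
  Set.mem_ofPred

theorem mul_mem_lattice {c d x y : F} (hx : x ∈ lattice c) (hy : y ∈ lattice d) :
    x * y ∈ lattice (c * d) := by
  rw [mem_lattice] at *
  rw [map_mul, map_mul]
  exact mul_le_mul' hx hy

theorem isCompact_lattice (c : F) : IsCompact (lattice c : Set F) :=
  IsNonarchimedeanLocalField.isCompact_closedBall F (valuation F c)

theorem isOpen_lattice {c : F} (hc : c ≠ 0) : IsOpen (lattice c : Set F) := by
  refine AddSubgroup.isOpen_of_mem_nhds _ (g := 0) ?_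
  refine (IsValuativeTopology.hasBasis_nhds_zero' F).mem_iff.2
    ⟨valuation F c, by simpa using hc, fun x hx => mem_lattice.2 (le_of_lt (Set.mem_ofPred.1 hx))⟩

theorem exists_lattice_subset {N : Set F} (hN : N ∈ 𝓝 (0 : F)) :
    ∃ c : F, c ≠ 0 ∧ (lattice c : Set F) ⊆ N := by
  obtain ⟨γ, hγ, h⟩ := (IsValuativeTopology.hasBasis_nhds_zero' F).mem_iff.1 hN
  obtain ⟨r, rfl⟩ := ValuativeRel.valuation_surjective γ
  obtain ⟨t, ht, ht1⟩ := Valuation.IsNontrivial.exists_lt_one (v := valuation F)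
  refine ⟨r * t, mul_ne_zero (by simpa using hγ) (by simpa using ht), fun x hx => h (Set.mem_ofPred.2 ?_)⟩
  refine lt_of_le_of_lt (mem_lattice.1 hx) ?_
  rw [map_mul]
  exact mul_lt_of_lt_one_right (zero_lt_iff.2 hγ) ht1

theorem coe_lattice_units_smul (u : Fˣ) (c : F) :
    (lattice ((u : F) * c) : Set F) = u • (lattice c : Set F) := by
  ext x
  rw [Set.mem_smul_set_iff_inv_smul_mem]
  simp only [SetLike.mem_coe, mem_lattice, Units.smul_def, smul_eq_mul, map_mul]
  rw [Units.val_inv_eq_inv_val, map_inv₀, inv_mul_le_iff₀ (by simp [zero_lt_iff])]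

theorem resCard_pos : 0 < resCard F := Nat.card_pos

end LocalFieldTopology

/-! ### The modulus of multiplication on `F` is a power of `q`. -/

section HaarModulus

open Topology Pointwise

variable {F : Type*} [Field F] [ValuativeRel F] [TopologicalSpace F]
  [IsNonarchimedeanLocalField F] [MeasurableSpace F] [BorelSpace F]

theorem measure_lattice_ne_top (m : Measure F) [m.IsAddHaarMeasure] (c : F) :
    m (lattice c) ≠ ⊤ := (isCompact_lattice c).measure_ne_top

theorem measure_lattice_ne_zero (m : Measure F) [m.IsAddHaarMeasure] {c : F} (hc : c ≠ 0) :
    m (lattice c) ≠ 0 :=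
  (isOpen_lattice hc).measure_ne_zero m ⟨0, (lattice c).zero_mem⟩

theorem measure_lattice_units_mul (m : Measure F) [m.IsAddHaarMeasure] (u : Fˣ) (c : F) :
    m (lattice ((u : F) * c)) = distribHaarChar F u * m (lattice c) := by
  rw [coe_lattice_units_smul, distribHaarChar_mul]

/-- The fibres of the residue map are `q` translates of the maximal ideal, which is `ϖ𝒪`. -/
theorem measure_lattice_one_eq (m : Measure F) [m.IsAddHaarMeasure] {ϖ : 𝒪[F]}
    (hϖ : Irreducible ϖ) : m (lattice (1 : F)) = resCard F * m (lattice (ϖ : F)) := by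
  have : Fintype 𝓀[F] := Fintype.ofFinite _
  let A : 𝓀[F] → Set F := fun k => {x | ∃ h : x ∈ 𝒪[F], IsLocalRing.residue 𝒪[F] ⟨x, h⟩ = k}
  have hmem : ∀ z : 𝒪[F], z ∈ 𝓂[F] ↔ (z : F) ∈ lattice (ϖ : F) := by
    intro z
    rw [hϖ.maximalIdeal_eq, Ideal.mem_span_singleton, mem_lattice]
    exact (Valuation.Integers.le_iff_dvd (Valuation.integer.integers (valuation F))).symm
  have hA : ∀ k, ∃ g, A k = (fun x => g + x) ⁻¹' (lattice (ϖ : F) : Set F) := by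
    intro k
    obtain ⟨z, rfl⟩ := IsLocalRing.residue_surjective k
    refine ⟨-(z : F), ?_⟩
    ext x
    constructor
    · rintro ⟨h, hx⟩
      have := (hmem _).1 (Ideal.Quotient.eq.1 hx)
      simpa [neg_add_eq_sub] using this
    · intro hx
      have hx' : -(z : F) + x ∈ 𝒪[F] :=
        (Valuation.mem_integer_iff _ _).2 ((mem_lattice.1 hx).trans ϖ.2)
      have hx0 : x ∈ 𝒪[F] := by simpa using add_mem z.2 hx'
      refine ⟨hx0, Ideal.Quotient.eq.2 ((hmem _).2 ?_)⟩
      simpa [neg_add_eq_sub] using hx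
  rw [resCard, Nat.card_eq_fintype_card, ← measure_iUnion_translates m A _ _ hA]
  · congr 1
    ext x
    simp only [Set.mem_iUnion]
    constructor
    · intro hx
      have hx0 : x ∈ 𝒪[F] := by
        simpa [mem_lattice, Valuation.mem_integer_iff] using hx
      exact ⟨_, hx0, rfl⟩
    · rintro ⟨k, hx0, -⟩
      have : valuation F x ≤ 1 := hx0
      simpa [mem_lattice] using this
  · intro k
    obtain ⟨g, hg⟩ := hA k
    rw [hg]
    exact measurable_const_add g (isCompact_lattice _).measurableSet
  · intro k l hkl
    refine Set.disjoint_left.2 ?_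
    rintro x ⟨h, rfl⟩ ⟨h', rfl⟩
    exact hkl rfl

/-- The modulus is multiplicative, is `1` on units of `𝒪` because they preserve `𝒪`, and is `q⁻¹` on
a uniformizer. An integral element is a unit times a power of the uniformizer; otherwise its inverse
is integral. -/
theorem distribHaarChar_eq_zpow (u : Fˣ) :
    ∃ k : ℤ, distribHaarChar F u = (resCard F : NNReal) ^ k := by
  let m : Measure F := Measure.addHaar
  have hone : ∀ v : Fˣ, valuation F (v : F) = 1 → distribHaarChar F v = 1 := by
    intro v hv
    refine distribHaarChar_eq_of_measure_smul_eq_mul (μ := m)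
      (measure_lattice_ne_zero m one_ne_zero) (measure_lattice_ne_top m (1 : F)) ?_
    rw [← coe_lattice_units_smul]
    simp [lattice, hv]
  obtain ⟨ϖ, hϖ⟩ := IsDiscreteValuationRing.exists_irreducible 𝒪[F]
  have hϖ0 : (ϖ : F) ≠ 0 := by simpa using hϖ.ne_zero
  have hq : (resCard F : NNReal) ≠ 0 := by exact_mod_cast (resCard_pos (F := F)).ne'
  have hpi : distribHaarChar F (Units.mk0 (ϖ : F) hϖ0) = (resCard F : NNReal)⁻¹ := by
    refine distribHaarChar_eq_of_measure_smul_eq_mul (μ := m)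
      (measure_lattice_ne_zero m one_ne_zero) (measure_lattice_ne_top m (1 : F)) ?_
    rw [← coe_lattice_units_smul, measure_lattice_one_eq m hϖ, ← mul_assoc, ENNReal.coe_inv hq,
      ENNReal.coe_natCast, ENNReal.inv_mul_cancel (by exact_mod_cast hq) (by simp), one_mul]
    simp
  have hint : ∀ v : Fˣ, valuation F (v : F) ≤ 1 →
      ∃ k : ℤ, distribHaarChar F v = (resCard F : NNReal) ^ k := by
    intro v hv
    obtain ⟨n, w, hw⟩ := IsDiscreteValuationRing.eq_unit_mul_pow_irreducible
      (x := (⟨(v : F), hv⟩ : 𝒪[F])) (fun h => v.ne_zero (congrArg Subtype.val h)) hϖ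
    have hw1 : valuation F ((w : 𝒪[F]) : F) = 1 :=
      (Valuation.integer.integers (valuation F)).isUnit_iff_valuation_eq_one.1 w.isUnit
    have hw0 : ((w : 𝒪[F]) : F) ≠ 0 := by
      intro h; rw [h, map_zero] at hw1; exact zero_ne_one hw1
    have hv' : v = Units.mk0 _ hw0 * Units.mk0 (ϖ : F) hϖ0 ^ n := by
      ext
      simpa using congrArg Subtype.val hw
    refine ⟨-n, ?_⟩
    rw [hv', map_mul, map_pow, hpi, hone _ hw1, one_mul, inv_pow, zpow_neg, zpow_natCast]
  rcases le_total (valuation F (u : F)) 1 with h | h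
  · exact hint u h
  · obtain ⟨k, hk⟩ := hint u⁻¹ (by
      rw [Units.val_inv_eq_inv_val, map_inv₀]; exact inv_le_one_of_one_le₀ h)
    refine ⟨-k, ?_⟩
    rw [zpow_neg, ← hk, map_inv, inv_inv]

/-- The measure of a lattice is an integral power of `q` times that of the ring of integers. -/
theorem exists_measure_lattice_eq (m : Measure F) [m.IsAddHaarMeasure] {c : F} (hc : c ≠ 0) :
    ∃ k : ℤ, m.real (lattice c) = (resCard F : ℝ) ^ k * m.real (lattice (1 : F)) := by
  obtain ⟨k, hk⟩ := distribHaarChar_eq_zpow (Units.mk0 c hc)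
  refine ⟨k, ?_⟩
  have := measure_lattice_units_mul m (Units.mk0 c hc) 1
  rw [Units.val_mk0, mul_one, hk] at this
  rw [measureReal_def, this, ENNReal.toReal_mul, measureReal_def]
  simp

end HaarModulus
end LocalWeil

end

noncomputable section

namespace LocalWeil

/-! ### Conductors, Fourier inversion and self-dual measures. -/

section Characters

open Topology Pointwise

/-- The circle has no small subgroups: as long as `w = z^(2^n)` is within `1/2` of `1`, `|w + 1| ≥
3/2`, so squaring multiplies the distance `|w - 1|` by at least `3/2`. -/
theorem circle_eq_one_of_pow_near_one {z : Circle} (h : ∀ n : ℕ, ‖((z ^ n : Circle) : ℂ) - 1‖ ≤ 1 / 2) :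
    z = 1 := by
  by_contra hz
  have hz' : 0 < ‖(z : ℂ) - 1‖ := norm_pos_iff.2 (sub_ne_zero.2 fun h => hz (Circle.ext (by simpa using h)))
  have hgrow : ∀ n : ℕ, (3 / 2 : ℝ) ^ n * ‖(z : ℂ) - 1‖ ≤ ‖((z ^ 2 ^ n : Circle) : ℂ) - 1‖ := by
    intro n
    induction n with
    | zero => simp
    | succ n ih =>
      set w : ℂ := ((z ^ 2 ^ n : Circle) : ℂ) with hw
      have h1 : ((z ^ 2 ^ (n + 1) : Circle) : ℂ) - 1 = (w - 1) * (w + 1) := by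
        rw [pow_succ, pow_mul, Circle.coe_pow, ← hw]; ring
      have h2 : (3 / 2 : ℝ) ≤ ‖w + 1‖ := by
        have h3 : ‖(2 : ℂ)‖ ≤ ‖w + 1‖ + ‖w - 1‖ := by
          calc ‖(2 : ℂ)‖ = ‖(w + 1) - (w - 1)‖ := by ring_nf
            _ ≤ _ := norm_sub_le _ _
        have h4 := h (2 ^ n)
        rw [← hw] at h4
        norm_num at h3
        linarith
      rw [h1, norm_mul, pow_succ]
      nlinarith [norm_nonneg (w - 1), norm_nonneg ((z : ℂ) - 1)]
  obtain ⟨n, hn⟩ := pow_unbounded_of_one_lt (1 / ‖(z : ℂ) - 1‖) (show (1 : ℝ) < 3 / 2 by norm_num)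
  rw [div_lt_iff₀ hz'] at hn
  linarith [hgrow n, h (2 ^ n)]

variable {F : Type*} [Field F] [ValuativeRel F] [TopologicalSpace F]
  [IsNonarchimedeanLocalField F]

/-- Lattices are subgroups and form arbitrarily small neighbourhoods of `0`, so the image of a small
one is a subgroup of the circle close to `1`, hence trivial. -/
theorem exists_lattice_le_ker {lam : AddChar F Circle} (hlam : Continuous lam) :
    ∃ c : F, c ≠ 0 ∧ ∀ x ∈ lattice c, lam x = 1 := by
  have hcont : Continuous fun x : F => ‖(lam x : ℂ) - 1‖ := by fun_prop
  have hN : {x : F | ‖(lam x : ℂ) - 1‖ < 1 / 2} ∈ 𝓝 (0 : F) :=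
    (isOpen_Iio.preimage hcont).mem_nhds (by simp)
  obtain ⟨c, hc, hcN⟩ := exists_lattice_subset hN
  refine ⟨c, hc, fun x hx => circle_eq_one_of_pow_near_one fun n => ?_⟩
  rw [← AddChar.map_nsmul_eq_pow]
  exact (Set.mem_ofPred.1 (hcN ((lattice c).nsmul_mem hx n))).le

theorem isLocallyConstant_addChar {lam : AddChar F Circle} (hlam : Continuous lam) :
    IsLocallyConstant lam := by
  obtain ⟨c, hc, h⟩ := exists_lattice_le_ker hlam
  rw [IsLocallyConstant.iff_eventually_eq]
  intro x
  have h1 : Filter.Tendsto (fun y => y - x) (𝓝 x) (𝓝 0) := by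
    simpa using (continuous_id.sub continuous_const).tendsto (f := fun y : F => y - x) x
  filter_upwards [h1 ((isOpen_lattice hc).mem_nhds (lattice c).zero_mem)] with y hy
  rw [← sub_add_cancel y x, AddChar.map_add_eq_mul, h _ hy, one_mul]

theorem pow_mul_mem_lattice {ϖ : F} (hϖ : valuation F ϖ < 1) (t : F) {c : F} (hc : c ≠ 0) :
    ∃ n : ℕ, ϖ ^ n * t ∈ lattice c := by
  by_cases ht : t = 0
  · exact ⟨0, by simp [ht, (lattice c).zero_mem]⟩
  · have h0 : valuation F c / valuation F t ≠ 0 := by simp [hc, ht]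
    have : MulArchimedean (ValueGroupWithZero F) := ValuativeRel.isRankLeOne_iff_mulArchimedean.1 inferInstance
    obtain ⟨n, hn⟩ := exists_pow_lt₀ hϖ (Units.mk0 _ h0)
    refine ⟨n, mem_lattice.2 ?_⟩
    rw [map_mul, map_pow]
    exact ((lt_div_iff₀ (zero_lt_iff.2 (by simpa using ht))).1 hn).le

theorem exists_valuation_uniformizer : ∃ ϖ : F, ϖ ≠ 0 ∧ valuation F ϖ < 1 ∧
    ∀ x : F, valuation F x < 1 → valuation F x ≤ valuation F ϖ := by
  obtain ⟨ϖ, hϖ⟩ := IsDiscreteValuationRing.exists_irreducible 𝒪[F]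
  have key : ∀ x : 𝒪[F], valuation F (x : F) < 1 ↔ x ∈ 𝓂[F] := by
    intro x
    rw [IsLocalRing.mem_maximalIdeal, mem_nonunits_iff,
      (Valuation.integer.integers (valuation F)).isUnit_iff_valuation_eq_one]
    exact lt_iff_le_and_ne.trans (and_iff_right x.2)
  refine ⟨ϖ, by simpa using hϖ.ne_zero, (key ϖ).2 ?_, fun x hx => ?_⟩
  · rw [hϖ.maximalIdeal_eq]; exact Ideal.mem_span_singleton_self ϖ
  · have := (key ⟨x, hx.le⟩).1 hx
    rw [hϖ.maximalIdeal_eq, Ideal.mem_span_singleton] at this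
    exact (Valuation.Integers.le_iff_dvd (Valuation.integer.integers (valuation F))).2 this

/-- The conductor of a nontrivial continuous character. -/
theorem exists_conductor {lam : AddChar F Circle} (hlam : Continuous lam) (hlam1 : lam ≠ 1) :
    ∃ c : F, c ≠ 0 ∧ ∀ s : F, s ∈ lattice c ↔ ∀ x ∈ lattice (1 : F), lam (s * x) = 1 := by
  classical
  obtain ⟨c₀, hc₀, h₀⟩ := exists_lattice_le_ker hlam
  obtain ⟨t, ht⟩ : ∃ t, lam t ≠ 1 := by
    by_contra! h
    exact hlam1 (DFunLike.ext _ _ h)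
  have ht0 : t ≠ 0 := by rintro rfl; simp at ht
  obtain ⟨ϖ, hϖ0, hϖ1, hϖ⟩ := exists_valuation_uniformizer (F := F)
  -- The conductor is `ϖ^n t 𝒪` for the least such `n`; it is positive because `lam t ≠ 1`.
  have hex : ∃ n : ℕ, ∀ x ∈ lattice (ϖ ^ n * t), lam x = 1 := by
    obtain ⟨n, hn⟩ := pow_mul_mem_lattice hϖ1 t hc₀
    exact ⟨n, fun x hx => h₀ x (le_trans (mem_lattice.1 hx) (mem_lattice.1 hn))⟩
  set n := Nat.find hex with hn
  have hn0 : n ≠ 0 := by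
    intro h
    refine ht (Nat.find_spec hex t ?_)
    rw [← hn, h]
    simp [mem_lattice]
  refine ⟨ϖ ^ n * t, mul_ne_zero (pow_ne_zero _ hϖ0) ht0, fun s => ⟨fun hs x hx => ?_, fun hs => ?_⟩⟩
  · exact Nat.find_spec hex _ (by simpa using mul_mem_lattice hs hx)
  · by_contra hsn
    rw [mem_lattice, not_le] at hsn
    have hs0 : s ≠ 0 := by rintro rfl; simp at hsn
    have hs0' : 0 < valuation F s := zero_lt_iff.2 (by simpa using hs0)
    -- If `s` lay outside `ϖ^n t 𝒪`, then `ϖ^(n-1) t 𝒪 ⊆ s𝒪`, where the character is trivial,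
    -- against the minimality of `n`.
    refine Nat.find_min hex (Nat.sub_lt (Nat.pos_of_ne_zero hn0) one_pos) fun x hx => ?_
    rw [← mul_div_cancel₀ x hs0]
    refine hs _ (mem_lattice.2 ?_)
    have h1 := hϖ (ϖ ^ n * t / s) (by rw [map_div₀]; exact (div_lt_one₀ hs0').2 hsn)
    rw [map_div₀, div_le_iff₀ hs0', ← Nat.succ_pred_eq_of_ne_zero hn0, pow_succ', mul_assoc,
      map_mul, mul_le_mul_iff_right₀ (zero_lt_iff.2 (by simpa using hϖ0))] at h1
    rw [map_div₀, map_one, div_le_one₀ hs0']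
    exact (mem_lattice.1 hx).trans h1

variable [MeasurableSpace F] [BorelSpace F]

theorem lattice_indicator_mem_schwartz {c : F} (hc : c ≠ 0) :
    (lattice c : Set F).indicator (fun _ => (1 : ℂ)) ∈ schwartz F ℂ := by
  refine ⟨(LocallyConstant.charFn ℂ ⟨(isCompact_lattice c).isClosed, isOpen_lattice hc⟩).isLocallyConstant,
    ?_⟩
  exact HasCompactSupport.intro (isCompact_lattice c) fun x hx => Set.indicator_of_notMem hx _

/-- Orthogonality: translating by an element `u` of the lattice with `lam (s * u) ≠ 1` multiplies
the integral by that value. -/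
theorem integral_addChar_lattice {lam : AddChar F Circle} (m : Measure F)
    [m.IsAddHaarMeasure] (e s : F) (h : ¬ ∀ x ∈ lattice e, lam (s * x) = 1) :
    ∫ t in (lattice e : Set F), (lam (s * t) : ℂ) ∂m = 0 := by
  push Not at h
  obtain ⟨u, hu, hu1⟩ := h
  have hmeas : MeasurableSet (lattice e : Set F) := (isCompact_lattice e).measurableSet
  rw [← integral_indicator hmeas]
  set f := (lattice e : Set F).indicator fun t => (lam (s * t) : ℂ) with hf
  have h1 : ∀ t, f (u + t) = (lam (s * u) : ℂ) * f t := by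
    intro t
    by_cases ht : t ∈ lattice e
    · rw [hf, Set.indicator_of_mem (show t ∈ (lattice e : Set F) from ht),
        Set.indicator_of_mem (show u + t ∈ (lattice e : Set F) from add_mem hu ht), mul_add,
        AddChar.map_add_eq_mul, Circle.coe_mul]
    · have ht' : u + t ∉ lattice e := fun h => ht (by simpa using sub_mem h hu)
      rw [hf, Set.indicator_of_notMem (show t ∉ (lattice e : Set F) from ht),
        Set.indicator_of_notMem (show u + t ∉ (lattice e : Set F) from ht'), mul_zero]
  have h2 : ∫ t, f t ∂m = (lam (s * u) : ℂ) * ∫ t, f t ∂m := by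
    rw [← integral_const_mul]
    simp_rw [← h1]
    exact (integral_add_left_eq_self f u).symm
  have h3 : ((lam (s * u) : ℂ) - 1) * ∫ t, f t ∂m = 0 := by rw [sub_mul, ← h2]; ring
  refine (mul_eq_zero.1 h3).resolve_left (sub_ne_zero.2 fun h => hu1 (Circle.ext (by simpa using h)))

theorem fourier_lattice_indicator {lam : AddChar F Circle} (m : Measure F)
    [m.IsAddHaarMeasure] {c : F}
    (hc : ∀ s : F, s ∈ lattice c ↔ ∀ x ∈ lattice (1 : F), lam (s * x) = 1) (s : F) :
    fourier lam m ((lattice (1 : F) : Set F).indicator fun _ => (1 : ℂ)) s =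
      (lattice c : Set F).indicator (fun _ => (m.real (lattice (1 : F)) : ℂ)) s := by
  have hmeas : MeasurableSet (lattice (1 : F) : Set F) := (isCompact_lattice 1).measurableSet
  have h1 : fourier lam m ((lattice (1 : F) : Set F).indicator fun _ => (1 : ℂ)) s =
      ∫ t in (lattice (1 : F) : Set F), (lam (s * t) : ℂ) ∂m := by
    rw [← integral_indicator hmeas, fourier]
    congr 1
    funext t
    by_cases ht : t ∈ (lattice (1 : F) : Set F)
    · simp [Set.indicator_of_mem ht, rescale]
    · simp [Set.indicator_of_notMem ht]
  rw [h1]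
  by_cases hs : s ∈ lattice c
  · rw [Set.indicator_of_mem (show s ∈ (lattice c : Set F) from hs),
      setIntegral_congr_fun hmeas (g := fun _ => (1 : ℂ))
        (fun t ht => by simp [(hc s).1 hs t ht])]
    simp
  · rw [Set.indicator_of_notMem (show s ∉ (lattice c : Set F) from hs)]
    exact integral_addChar_lattice m 1 s fun h => hs ((hc s).2 h)

/-- For the self-dual measure, the measure of the ring of integers is an integral power of `√q`. -/
theorem IsSelfDual.measure_lattice_sq {lam : AddChar F Circle} (hlam : Continuous lam)
    (hlam1 : lam ≠ 1) {m : Measure F} (hm : IsSelfDual lam m) :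
    ∃ k : ℤ, m.real (lattice (1 : F)) ^ 2 = (resCard F : ℝ) ^ k := by
  have := hm.1
  obtain ⟨c, hc0, hc⟩ := exists_conductor hlam hlam1
  obtain ⟨k, hk⟩ := exists_measure_lattice_eq m hc0
  refine ⟨-k, ?_⟩
  -- Inversion at `0` for the indicator of `𝒪` reads `m(𝒪) m(c𝒪) = 1`, and `m(c𝒪) = q^k m(𝒪)`.
  have h1 := hm.2 _ (lattice_indicator_mem_schwartz one_ne_zero) 0
  rw [show fourier lam m _ = _ from funext (fourier_lattice_indicator m hc), fourier,
    neg_zero, Set.indicator_of_mem (show (0 : F) ∈ (lattice (1 : F) : Set F) from zero_mem _)] at h1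
  have h2 : ∀ t : F, (rescale lam 0 t : ℂ) = 1 := fun t => by
    simp [rescale]
  simp_rw [h2, one_mul] at h1
  rw [integral_indicator_const _ (isCompact_lattice c).measurableSet, hk] at h1
  have h3 : (resCard F : ℝ) ^ k * m.real (lattice (1 : F)) ^ 2 = 1 := by
    have : (((resCard F : ℝ) ^ k * m.real (lattice (1 : F)) * m.real (lattice (1 : F)) : ℝ) : ℂ)
        = (1 : ℝ) := by
      rw [← Complex.real_smul.trans (Complex.ofReal_mul _ _).symm, h1, Complex.ofReal_one]
    rw [← Complex.ofReal_injective this]; ring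
  have hq : (resCard F : ℝ) ^ k ≠ 0 := zpow_ne_zero _ (by exact_mod_cast (resCard_pos (F := F)).ne')
  rw [zpow_neg, eq_inv_of_mul_eq_one_right h3]

theorem map_mul_left_eq_self (m : Measure F) [m.IsAddHaarMeasure] {s : F}
    (hs : valuation F s = 1) : m.map (s * ·) = m := by
  have hs0 : s ≠ 0 := by rintro rfl; simp at hs
  have hd : distribHaarChar F (Units.mk0 s hs0) = 1 := by
    refine distribHaarChar_eq_of_measure_smul_eq_mul (μ := m)
      (measure_lattice_ne_zero m one_ne_zero) (measure_lattice_ne_top m (1 : F)) ?_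
    rw [← coe_lattice_units_smul]
    simp [lattice, hs]
  ext A hA
  rw [Measure.map_apply (by fun_prop) hA]
  have h1 : A = Units.mk0 s hs0 • ((s * ·) ⁻¹' A) := by
    ext x
    rw [Set.mem_smul_set_iff_inv_smul_mem]
    simp [Units.smul_def, hs0]
  conv_rhs => rw [h1]
  rw [← distribHaarChar_mul, hd]
  simp

theorem integral_comp_mul_left_eq_self (m : Measure F) [m.IsAddHaarMeasure] {s : F}
    (hs : valuation F s = 1) (f : F → ℂ) : ∫ u, f (s * u) ∂m = ∫ u, f u ∂m := by
  have hs0 : s ≠ 0 := by rintro rfl; simp at hs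
  conv_rhs => rw [← map_mul_left_eq_self m hs]
  exact ((Homeomorph.mulLeft₀ s hs0).measurableEmbedding.integral_map f).symm

theorem fourier_rescale (lam : AddChar F Circle) (m : Measure F) (s : F) (φ : F → ℂ) (t : F) :
    fourier (rescale lam s) m φ t = fourier lam m φ (s * t) := by
  simp only [fourier, rescale, AddChar.mulShift_apply, mul_assoc]

/-- Passing to `lam[s]` replaces the argument `u` of each transform by `su`; in the outer integral
the substitution `u ↦ su`, which preserves the measure, removes `s` again. -/
theorem IsSelfDual.rescale {lam : AddChar F Circle} {m : Measure F} (hm : IsSelfDual lam m) {s : F}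
    (hs : valuation F s = 1) : IsSelfDual (rescale lam s) m := by
  have := hm.1
  refine ⟨hm.1, fun φ hφ t => ?_⟩
  rw [← hm.2 φ hφ t, fourier, fourier,
    ← integral_comp_mul_left_eq_self m hs fun u => (LocalWeil.rescale lam t u : ℂ) * _]
  simp only [fourier_rescale]
  congr 1
  funext u
  simp only [LocalWeil.rescale, AddChar.mulShift_apply]
  rw [mul_left_comm]

/-- The predicates `IsSelfDual` for the two characters are equal, so the same measure is chosen for
both and uniqueness of self-dual measures is not needed. The converse implication is rescaling by
`s⁻¹`. -/
theorem selfDual_rescale (lam : AddChar F Circle) {s : F} (hs : valuation F s = 1) :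
    selfDual (rescale lam s) = selfDual lam := by
  have hs0 : s ≠ 0 := by rintro rfl; simp at hs
  have : IsSelfDual (rescale lam s) = IsSelfDual lam := by
    funext m
    refine propext ⟨fun h => ?_, fun h => h.rescale hs⟩
    have h1 := h.rescale (s := s⁻¹) (by simp [hs])
    have h2 : rescale (rescale lam s) s⁻¹ = lam := by
      ext x
      simp [rescale, AddChar.mulShift_apply, hs0]
    rwa [h2] at h1
  unfold selfDual
  rw [this]

theorem fourier_eq_zero {lam : AddChar F Circle} (m : Measure F) [m.IsAddHaarMeasure] {φ : F → ℂ}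
    {s h : F} (hφ : ∀ x, φ (x + h) = φ x) (hs : lam (s * h) ≠ 1) : fourier lam m φ s = 0 := by
  have h2 : fourier lam m φ s = (lam (s * h) : ℂ) * fourier lam m φ s := by
    conv_lhs => rw [fourier, ← integral_add_right_eq_self _ h]
    rw [fourier, ← integral_const_mul]
    congr 1
    funext t
    rw [hφ, rescale, AddChar.mulShift_apply, AddChar.mulShift_apply, mul_add,
      AddChar.map_add_eq_mul, Circle.coe_mul]
    ring
  have h3 : ((lam (s * h) : ℂ) - 1) * fourier lam m φ s = 0 := by rw [sub_mul, ← h2]; ring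
  exact (mul_eq_zero.1 h3).resolve_left (sub_ne_zero.2 fun h => hs (Circle.ext (by simpa using h)))

/-- Fourier inversion for the correctly normalized Haar measure. -/
theorem fourier_fourier {lam : AddChar F Circle} (hlam : Continuous lam) (m : Measure F)
    [m.IsAddHaarMeasure] {c : F}
    (hc : ∀ s : F, s ∈ lattice c ↔ ∀ x ∈ lattice (1 : F), lam (s * x) = 1)
    (hm : m.real (lattice (1 : F)) * m.real (lattice c) = 1) {φ : F → ℂ} (hφ : φ ∈ schwartz F ℂ)
    (u : F) : fourier lam m (fourier lam m φ) u = φ (-u) := by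
  have hc0 : c ≠ 0 := by
    rintro rfl
    obtain ⟨c₀, hc₀, h₀⟩ := exists_lattice_le_ker hlam
    have h1 : c₀ ∈ lattice (0 : F) := (hc c₀).2 fun x hx => h₀ _ (by
      simpa using mul_mem_lattice (c := c₀) (mem_lattice.2 le_rfl) hx)
    simp [mem_lattice, hc₀] at h1
  obtain ⟨N, hN, hφN⟩ := exists_nhds_forall_add_eq hφ.1 hφ.2
  obtain ⟨d, hd0, hdN⟩ := exists_lattice_subset hN
  have hcd0 : c / d ≠ 0 := div_ne_zero hc0 hd0
  -- Here `d𝒪` is a lattice of periods of `φ`. Its dual lattice for `lam` is `(c/d)𝒪`, so the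
  -- transform of `φ` is supported there.
  have hdual : ∀ w : F, w ∈ lattice d ↔ ∀ x ∈ lattice (c / d), lam (w * x) = 1 := by
    intro w
    constructor
    · intro hw x hx
      have h1 : w * x ∈ lattice c := by simpa [mul_div_cancel₀ _ hd0] using mul_mem_lattice hw hx
      simpa using (hc _).1 h1 1 (mem_lattice.2 le_rfl)
    · intro hw
      have h1 : w * (c / d) ∈ lattice c := (hc _).2 fun x hx => by
        rw [mul_assoc]
        exact hw _ (by simpa using mul_mem_lattice (c := c / d) (mem_lattice.2 le_rfl) hx)
      rw [mem_lattice, map_mul, map_div₀, mul_div_left_comm] at h1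
      have h2 := (mul_le_iff_le_one_right (zero_lt_iff.2 (show valuation F c ≠ 0 by simpa using hc0))).1
        h1
      rwa [div_le_one₀ (zero_lt_iff.2 (by simpa using hd0))] at h2
  set L : Set F := (lattice (c / d) : Set F) with hL
  have hLcl : IsClopen L := ⟨(isCompact_lattice _).isClosed, isOpen_lattice hcd0⟩
  have hsupp : ∀ s, s ∉ L → fourier lam m φ s = 0 := by
    intro s hs
    have h1 : s * d ∉ lattice c := fun h => hs (by
      rw [hL, SetLike.mem_coe, mem_lattice, map_div₀, le_div_iff₀ (zero_lt_iff.2 (by simpa using hd0)),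
        ← map_mul]
      exact h)
    rw [hc] at h1
    push Not at h1
    obtain ⟨x, hx, hx1⟩ := h1
    rw [mul_assoc] at hx1
    exact fourier_eq_zero m (fun y => hφN _ (hdN (by
      simpa using mul_mem_lattice (c := d) (mem_lattice.2 le_rfl) hx)) y) hx1
  -- The indicator of `L` costs nothing, since the transform vanishes off `L`, and makes the double
  -- integral absolutely convergent so that Fubini applies.
  let G : F → F → ℂ := fun s t => L.indicator (fun _ => (1 : ℂ)) s * lam (u * s) * (lam (s * t) * φ t)
  have h1 : fourier lam m (fourier lam m φ) u = ∫ s, ∫ t, G s t ∂m ∂m := by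
    rw [fourier]
    congr 1
    funext s
    simp only [G]
    rw [integral_const_mul]
    by_cases hs : s ∈ L
    · simp [Set.indicator_of_mem hs, fourier, rescale]
    · simp [Set.indicator_of_notMem hs, hsupp s hs]
  have hG : Integrable (Function.uncurry G) (m.prod m) := by
    refine Continuous.integrable_of_hasCompactSupport ?_ ?_
    · have hφc : Continuous φ := hφ.1.continuous
      have hLc : Continuous (L.indicator fun _ => (1 : ℂ)) :=
        (LocallyConstant.charFn ℂ hLcl).continuous
      simp only [Function.uncurry_def, G]
      fun_prop
    · refine HasCompactSupport.intro ((isCompact_lattice (c / d)).prod hφ.2.isCompact) ?_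
      rintro ⟨s, t⟩ hst
      simp only [Function.uncurry_apply_pair, G]
      by_cases hs : s ∈ L
      · have ht : t ∉ tsupport φ := fun ht => hst ⟨hs, ht⟩
        rw [image_eq_zero_of_notMem_tsupport ht]; ring
      · rw [Set.indicator_of_notMem hs]; ring
  have h2 : ∀ t, ∫ s, G s t ∂m =
      (m.real L : ℂ) * ((lattice d : Set F).indicator (fun _ => (1 : ℂ)) (t + u) * φ t) := by
    intro t
    have h3 : ∀ s, G s t = φ t * L.indicator (fun s => (lam ((t + u) * s) : ℂ)) s := by
      intro s
      by_cases hs : s ∈ L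
      · simp only [G, Set.indicator_of_mem hs]
        rw [add_mul, AddChar.map_add_eq_mul, Circle.coe_mul, mul_comm s t]
        ring
      · simp only [G, Set.indicator_of_notMem hs]; ring
    simp_rw [h3]
    rw [integral_const_mul, integral_indicator hLcl.1.measurableSet]
    by_cases ht : t + u ∈ lattice d
    · rw [Set.indicator_of_mem (show t + u ∈ (lattice d : Set F) from ht),
        setIntegral_congr_fun hLcl.1.measurableSet (g := fun _ => (1 : ℂ))
        (fun s hs => by simp [(hdual _).1 ht s hs])]
      simp
      ring
    · rw [Set.indicator_of_notMem (show t + u ∉ (lattice d : Set F) from ht),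
        integral_addChar_lattice m (c / d) (t + u) fun h => ht ((hdual _).2 h)]
      simp
  rw [h1, integral_integral_swap hG]
  simp_rw [h2]
  rw [integral_const_mul, ← integral_add_right_eq_self _ (-u)]
  -- After the shift by `-u`, the inner integral restricts `t` to `d𝒪`, where `φ(t - u) = φ(-u)` by
  -- periodicity.
  have h4 : ∀ t, (lattice d : Set F).indicator (fun _ => (1 : ℂ)) (t + -u + u) * φ (t + -u) =
      (lattice d : Set F).indicator (fun _ => φ (-u)) t := by
    intro t
    rw [neg_add_cancel_right]
    by_cases ht : t ∈ (lattice d : Set F)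
    · rw [Set.indicator_of_mem ht, Set.indicator_of_mem ht, one_mul, add_comm, hφN t (hdN ht)]
    · rw [Set.indicator_of_notMem ht, Set.indicator_of_notMem ht, zero_mul]
  simp_rw [h4]
  rw [integral_indicator_const _ (isCompact_lattice d).measurableSet]
  -- The modulus of `d` cancels, leaving the hypothesis `m(𝒪) m(c𝒪) = 1`.
  have h5 : m.real L * m.real (lattice d) = 1 := by
    have e1 := measure_lattice_units_mul m (Units.mk0 d hd0) (c / d)
    have e2 := measure_lattice_units_mul m (Units.mk0 d hd0) 1
    rw [Units.val_mk0, mul_div_cancel₀ _ hd0] at e1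
    rw [Units.val_mk0, mul_one] at e2
    rw [← hm, measureReal_def, measureReal_def, measureReal_def, measureReal_def, e1, e2,
      ENNReal.toReal_mul, ENNReal.toReal_mul]
    ring
  rw [Complex.real_smul, ← mul_assoc, ← Complex.ofReal_mul, h5, Complex.ofReal_one, one_mul]

/-- Any Haar measure becomes self-dual after division by the square root of `m₀(𝒪) m₀(c𝒪)`, with
`c𝒪` the conductor. -/
theorem exists_isSelfDual {lam : AddChar F Circle} (hlam : Continuous lam) (hlam1 : lam ≠ 1) :
    ∃ m, IsSelfDual lam m := by
  obtain ⟨c, hc0, hc⟩ := exists_conductor hlam hlam1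
  let m₀ : Measure F := Measure.addHaar
  have hpos : ∀ e : F, e ≠ 0 → 0 < m₀.real (lattice e) := fun e he =>
    ENNReal.toReal_pos (measure_lattice_ne_zero m₀ he) (measure_lattice_ne_top m₀ e)
  set A := m₀.real (lattice (1 : F)) * m₀.real (lattice c) with hA
  have hA0 : 0 < A := mul_pos (hpos 1 one_ne_zero) (hpos c hc0)
  have hr : 0 < (√A)⁻¹ := inv_pos.2 (Real.sqrt_pos.2 hA0)
  let r : NNReal := ⟨(√A)⁻¹, hr.le⟩
  have hr0 : r ≠ 0 := fun h => hr.ne' (congrArg NNReal.toReal h)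
  have : (r • m₀).IsAddHaarMeasure := Measure.IsAddHaarMeasure.nnreal_smul m₀ hr0
  refine ⟨r • m₀, this, fun φ hφ u => fourier_fourier hlam _ hc ?_ hφ u⟩
  rw [measureReal_nnreal_smul_apply, measureReal_nnreal_smul_apply]
  calc (√A)⁻¹ * m₀.real (lattice (1 : F)) * ((√A)⁻¹ * m₀.real (lattice c))
      = (√A * √A)⁻¹ * A := by rw [mul_inv, hA]; ring
    _ = 1 := by rw [Real.mul_self_sqrt hA0.le, inv_mul_cancel₀ hA0.ne']

theorem isSelfDual_selfDual {lam : AddChar F Circle} (hlam : Continuous lam) (hlam1 : lam ≠ 1) :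
    IsSelfDual lam (selfDual lam) := by
  have h := exists_isSelfDual hlam hlam1
  rw [selfDual, dif_pos h]
  exact h.choose_spec

end Characters

end LocalWeil

end

noncomputable section

namespace LocalWeil

/-! ### The Galois action on character values, and `√q`. -/

section Galois

open Topology Pointwise

variable {F : Type*} [Field F] [ValuativeRel F] [TopologicalSpace F]
  [IsNonarchimedeanLocalField F]

theorem resChar_prime : (resChar F).Prime :=
  have : CharP 𝓀[F] (resChar F) := ringChar.charP _
  CharP.char_is_prime 𝓀[F] _

theorem valuation_resChar_lt_one : valuation F (resChar F : F) < 1 := by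
  have h : IsLocalRing.residue 𝒪[F] (resChar F : 𝒪[F]) = 0 := by
    rw [map_natCast]; exact ringChar.Nat.cast_ringChar
  rw [IsLocalRing.residue_eq_zero_iff, IsLocalRing.mem_maximalIdeal, mem_nonunits_iff,
    (Valuation.integer.integers (valuation F)).isUnit_iff_valuation_eq_one] at h
  exact lt_of_le_of_ne (resChar F : 𝒪[F]).2 h

/-- The values of a continuous character are `p`-power roots of unity. -/
theorem exists_pow_resChar_eq_one {lam : AddChar F Circle} (hlam : Continuous lam) (x : F) :
    ∃ n : ℕ, lam x ^ (resChar F ^ n) = 1 := by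
  obtain ⟨c, hc, h⟩ := exists_lattice_le_ker hlam
  obtain ⟨n, hn⟩ := pow_mul_mem_lattice valuation_resChar_lt_one x hc
  refine ⟨n, ?_⟩
  rw [← AddChar.map_nsmul_eq_pow, nsmul_eq_mul]
  exact h _ (by simpa using hn)

theorem primeClosure_subset_integers : (primeClosure F : Set F) ⊆ 𝒪[F] := by
  have h : (primeClosure F : Set F) = closure ((⊥ : Subring F) : Set F) := rfl
  rw [h]
  refine closure_minimal (show (⊥ : Subring F) ≤ 𝒪[F] from bot_le) ?_
  have : IsClosed {x : F | valuation F x ≤ 1} :=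
    (IsNonarchimedeanLocalField.isCompact_closedBall F 1).isClosed
  exact this

/-- Both `s` and its inverse lie in `𝒫 ⊆ 𝒪`. This is why rescaling by `s` leaves self-dual measures
unchanged. -/
theorem valuation_primeClosure_unit (s : (primeClosure F)ˣ) :
    valuation F ((s : primeClosure F) : F) = 1 := by
  have h1 : valuation F ((s : primeClosure F) : F) ≤ 1 := primeClosure_subset_integers (s : primeClosure F).2
  have h2 : valuation F (((s⁻¹ : (primeClosure F)ˣ) : primeClosure F) : F) ≤ 1 :=
    primeClosure_subset_integers ((s⁻¹ : (primeClosure F)ˣ) : primeClosure F).2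
  have h3 : ((s : primeClosure F) : F) * (((s⁻¹ : (primeClosure F)ˣ) : primeClosure F) : F) = 1 := by
    rw [← Subring.coe_mul, Units.mul_inv]; rfl
  have h4 := congrArg (valuation F) h3
  rw [map_mul, map_one] at h4
  refine le_antisymm h1 ?_
  rw [← h4]
  exact mul_le_of_le_one_right' h2

theorem isCompact_primeClosure : IsCompact (primeClosure F : Set F) := by
  refine IsCompact.of_isClosed_subset (IsNonarchimedeanLocalField.isCompact_closedBall F 1)
    (Subring.isClosed_topologicalClosure _) primeClosure_subset_integers

/-- The integers are dense in `𝒫` for the `p`-adic topology. -/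
theorem exists_int_add_pow_mul (s : primeClosure F) {N : ℕ} (hN : N ≠ 0) :
    ∃ (r : ℤ) (t : primeClosure F), s = (r : primeClosure F) + (N : primeClosure F) * t := by
  -- The union of the sets `i + N𝒫`, `0 ≤ i < N`, is compact, hence closed, and contains the prime
  -- ring by division with remainder; so it contains `𝒫`.
  let C : Set F := ⋃ i ∈ Finset.range N, (fun t : F => (i : F) + N * t) '' (primeClosure F : Set F)
  have hC : IsClosed C := by
    refine isClosed_biUnion_finset fun i _ => IsCompact.isClosed ?_
    exact isCompact_primeClosure.image (by fun_prop)
  have hsub : ((⊥ : Subring F) : Set F) ⊆ C := by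
    rintro x hx
    obtain ⟨k, rfl⟩ := Subring.mem_bot.1 hx
    have hN' : (N : ℤ) ≠ 0 := by exact_mod_cast hN
    refine Set.mem_biUnion (x := (k % N).toNat) ?_ ⟨((k / N : ℤ) : F), ?_, ?_⟩
    · have := Int.emod_lt_of_pos k (b := N) (by positivity)
      have := Int.emod_nonneg k hN'
      simp only [Finset.coe_range, Set.mem_Iio]
      omega
    · exact intCast_mem (primeClosure F) _
    · have h1 : (((k % N).toNat : ℤ)) + N * (k / N) = k := by
        rw [Int.toNat_of_nonneg (Int.emod_nonneg k hN'), Int.emod_add_mul_ediv]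
      have h2 := congrArg (Int.cast : ℤ → F) h1
      push_cast at h2
      exact h2
  have hs : (s : F) ∈ C := closure_minimal hsub hC s.2
  simp only [C, Set.mem_iUnion] at hs
  obtain ⟨i, -, t, ht, hst⟩ := hs
  refine ⟨i, ⟨t, ht⟩, Subtype.ext ?_⟩
  push_cast
  exact hst.symm

/-- The multipliers `x` with `lam (x * y) = 1` form a closed set containing the integers. -/
theorem addChar_primeClosure_mul_eq_one {lam : AddChar F Circle} (hlam : Continuous lam) {y : F}
    (hy : lam y = 1) (t : primeClosure F) : lam (t * y) = 1 := by
  have hcl : IsClosed {x : F | lam (x * y) = 1} := isClosed_eq (by fun_prop) continuous_const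
  refine closure_minimal (s := ((⊥ : Subring F) : Set F)) ?_ hcl t.2
  intro x hx
  obtain ⟨k, rfl⟩ := Subring.mem_bot.1 hx
  rw [Set.mem_ofPred_eq, ← zsmul_eq_mul, AddChar.map_zsmul_eq_zpow, hy, one_zpow]

/-- `σ_s` maps `lam x` to `lam (s * x)`. -/
theorem IsSigma.apply_coe {lam : AddChar F Circle} (hlam : Continuous lam)
    {s : (primeClosure F)ˣ} {τ : charField lam ≃ₐ[ℚ] charField lam} (hτ : IsSigma lam s τ) (x : F) :
    (τ ⟨(lam x : ℂ), coe_mem_charField lam x⟩ : ℂ) = lam ((s : primeClosure F) * x) := by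
  obtain ⟨n, hn⟩ := exists_pow_resChar_eq_one hlam x
  obtain ⟨r, t, hrt⟩ := exists_int_add_pow_mul (s : primeClosure F)
    (pow_ne_zero n (resChar_prime (F := F)).ne_zero)
  rw [hτ n r ⟨t, by simpa using hrt⟩ x hn, hrt]
  -- In `s x = r x + t (p^n x)` the last term is killed because `lam (p^n x) = 1`; what remains is
  -- `lam x ^ r`.
  have h1 : ((r : primeClosure F) + ((resChar F ^ n : ℕ) : primeClosure F) * t : primeClosure F) * x
      = r • x + t * ((resChar F ^ n) • x) := by
    simp only [zsmul_eq_mul, nsmul_eq_mul]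
    push_cast
    ring
  rw [h1, AddChar.map_add_eq_mul, addChar_primeClosure_mul_eq_one hlam (by
    rw [AddChar.map_nsmul_eq_pow, hn]), mul_one, AddChar.map_zsmul_eq_zpow, Circle.coe_zpow]
  exact map_zpow₀ (charField lam).val _ _

theorem exists_resCard_eq_pow : ∃ f : ℕ, resCard F = resChar F ^ f := by
  have : Fintype 𝓀[F] := Fintype.ofFinite _
  have : CharP 𝓀[F] (resChar F) := ringChar.charP _
  obtain ⟨f, -, hf⟩ := FiniteField.card 𝓀[F] (resChar F)
  exact ⟨f, by rw [resCard, Nat.card_eq_fintype_card, hf]⟩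

/-- A nontrivial continuous character has a primitive `p`-th root of unity among its values. -/
theorem exists_isPrimitiveRoot {lam : AddChar F Circle} (hlam : Continuous lam) (hlam1 : lam ≠ 1) :
    ∃ x : F, IsPrimitiveRoot (lam x : ℂ) (resChar F) := by
  classical
  obtain ⟨t, ht⟩ : ∃ t, lam t ≠ 1 := by
    by_contra! h
    exact hlam1 (DFunLike.ext _ _ h)
  have hex := exists_pow_resChar_eq_one hlam t
  set n := Nat.find hex with hn
  have hn0 : n ≠ 0 := fun h => ht (by have := Nat.find_spec hex; rwa [← hn, h, pow_zero, pow_one] at this)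
  -- With `n` minimal, `lam t ^ (p^(n-1))` has order exactly `p`.
  refine ⟨(resChar F ^ (n - 1)) • t, ?_⟩
  have h1 : lam (resChar F ^ (n - 1) • t) ^ resChar F = 1 := by
    rw [AddChar.map_nsmul_eq_pow, ← pow_mul, ← pow_succ, Nat.sub_add_cancel (Nat.pos_of_ne_zero hn0)]
    exact Nat.find_spec hex
  have h2 : lam (resChar F ^ (n - 1) • t) ≠ 1 := by
    rw [AddChar.map_nsmul_eq_pow]
    exact Nat.find_min hex (Nat.sub_lt (Nat.pos_of_ne_zero hn0) one_pos)
  have := orderOf_eq_prime (hp := ⟨resChar_prime⟩) (x := (lam (resChar F ^ (n - 1) • t) : ℂ))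
    (by rw [← Circle.coe_pow, h1, Circle.coe_one])
    (fun h => h2 (Circle.ext (by simpa using h)))
  have h3 := IsPrimitiveRoot.orderOf (lam (resChar F ^ (n - 1) • t) : ℂ)
  rwa [this] at h3

/-- `√q` lies in every field that contains the values of a nontrivial continuous character
and `√-1`: this is the evaluation of the square of the quadratic Gauss sum. -/
theorem sqrt_resCard_mem (hp : resChar F ≠ 2) {lam : AddChar F Circle} (hlam : Continuous lam)
    (hlam1 : lam ≠ 1) {K : IntermediateField ℚ ℂ} (hK : ∀ x, (lam x : ℂ) ∈ K) (hI : Complex.I ∈ K) :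
    ((√(resCard F : ℝ) : ℝ) : ℂ) ∈ K := by
  have : Fact (resChar F).Prime := ⟨resChar_prime⟩
  obtain ⟨f, hf⟩ := exists_resCard_eq_pow (F := F)
  have hsqrt : √((resChar F : ℝ) ^ f) = √(resChar F : ℝ) ^ f := by
    rw [Real.sqrt_eq_iff_mul_self_eq (by positivity) (by positivity), ← mul_pow,
      Real.mul_self_sqrt (by positivity)]
  rw [hf, Nat.cast_pow, hsqrt]
  push_cast
  refine pow_mem ?_ _
  obtain ⟨x, hx⟩ := exists_isPrimitiveRoot hlam hlam1
  -- It suffices to treat `√p`, as `q = p^f`. The Gauss sum of the quadratic character mod `p`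
  -- against `ψ` lies in `K`, and its square is `χ(-1) p`; if `χ(-1) = -1`, it is multiplied by
  -- `√-1`.
  let ψ := AddChar.zmodChar (resChar F) ((IsPrimitiveRoot.iff_def _ _).mp hx).left
  have hψ : ψ.IsPrimitive := AddChar.zmodChar_primitive_of_primitive_root _ hx
  let χ : MulChar (ZMod (resChar F)) ℂ := (quadraticChar (ZMod (resChar F))).ringHomComp (Int.castRingHom ℂ)
  have hχ : χ.IsQuadratic := (quadraticChar_isQuadratic _).comp _
  have hχ1 : χ ≠ 1 := by
    rw [Ne, MulChar.ringHomComp_eq_one_iff (RingHom.injective_int _)]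
    exact quadraticChar_ne_one (by rwa [ZMod.ringChar_zmod_n])
  have hG := gaussSum_sq hχ1 hχ hψ
  have hGK : gaussSum χ ψ ∈ K := by
    refine sum_mem fun a _ => mul_mem ?_ ?_
    · exact intCast_mem K _
    · rw [AddChar.zmodChar_apply]
      exact pow_mem (hK x) _
  have hsq : ((√(resChar F : ℝ) : ℝ) : ℂ) ^ 2 = resChar F := by
    rw [← Complex.ofReal_pow, Real.sq_sqrt (by positivity), Complex.ofReal_natCast]
  rw [ZMod.card, ← hsq] at hG
  have hχm : χ (-1) = 1 ∨ χ (-1) = -1 := by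
    rcases hχ (-1) with h | h
    · exact absurd h (IsUnit.ne_zero (isUnit_neg_one.map χ))
    · exact h
  rcases hχm with h | h
  · rw [h, one_mul] at hG
    rcases sq_eq_sq_iff_eq_or_eq_neg.1 hG with h | h
    · rw [← h]; exact hGK
    · rw [← neg_neg ((√(resChar F : ℝ) : ℝ) : ℂ), ← h]; exact neg_mem hGK
  · have hG' : (Complex.I * gaussSum χ ψ) ^ 2 = ((√(resChar F : ℝ) : ℝ) : ℂ) ^ 2 := by
      rw [mul_pow, hG, h, Complex.I_sq]; ring
    have := mul_mem hI hGK
    rcases sq_eq_sq_iff_eq_or_eq_neg.1 hG' with h | h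
    · rw [← h]; exact this
    · rw [← neg_neg ((√(resChar F : ℝ) : ℝ) : ℂ), ← h]; exact neg_mem this

end Galois

end LocalWeil

end

noncomputable section

namespace LocalWeil

namespace Polarization

/-! ### The Bruhat decomposition relative to `P`. -/

section Factorization

variable {F V : Type*} [Field F] [AddCommGroup V] [Module F V] (D : Polarization F V)

theorem basis_inl (j : Fin D.n) : D.basis (Sum.inl j) = (D.x j : V) := by
  simp [basis]

theorem basis_inr (j : Fin D.n) : D.basis (Sum.inr j) = (D.y j : V) := by
  simp [basis]

theorem tau_x (i : ℕ) (j : Fin D.n) :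
    D.tau i (D.x j : V) = if (j : ℕ) < i then -(D.y j : V) else (D.x j : V) := by
  rw [tau, ← basis_inl, Module.Basis.constr_basis, Sum.elim_inl]
  simp [basis_inl]

theorem tau_y (i : ℕ) (j : Fin D.n) :
    D.tau i (D.y j : V) = if (j : ℕ) < i then (D.x j : V) else (D.y j : V) := by
  rw [tau, ← basis_inr, Module.Basis.constr_basis, Sum.elim_inr]
  simp [basis_inr]

theorem form_y_x (i j : Fin D.n) : D.form (D.y i) (D.x j) = if j = i then -1 else 0 := by
  rw [← D.alt.neg_eq, D.dual]
  split_ifs <;> simp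

/-- A linear map that maps the symplectic basis to a symplectic basis preserves the form. -/
theorem form_map_eq_of_basis {T : V →ₗ[F] V}
    (hx : ∀ i j, D.form (T (D.x i)) (T (D.x j)) = 0)
    (hy : ∀ i j, D.form (T (D.y i)) (T (D.y j)) = 0)
    (hxy : ∀ i j, D.form (T (D.x i)) (T (D.y j)) = if i = j then 1 else 0) (v w : V) :
    D.form (T v) (T w) = D.form v w := by
  have h : D.form.compl₁₂ T T = D.form := by
    refine LinearMap.ext_basis D.basis D.basis ?_
    rintro (i | i) (j | j)
    · simp only [LinearMap.compl₁₂_apply, basis_inl]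
      rw [hx, D.isotropic_X _ (D.x i).2 _ (D.x j).2]
    · simp only [LinearMap.compl₁₂_apply, basis_inl, basis_inr]
      rw [hxy, D.dual]
    · simp only [LinearMap.compl₁₂_apply, basis_inl, basis_inr]
      rw [← D.alt.neg_eq, hxy, form_y_x]
      split_ifs <;> simp
    · simp only [LinearMap.compl₁₂_apply, basis_inr]
      rw [hy, D.isotropic_Y _ (D.y i).2 _ (D.y j).2]
  exact LinearMap.congr_fun₂ h v w

theorem eq_zero_of_form_eq_zero {v : V} (h : ∀ w, D.form v w = 0) : v = 0 :=
  D.nondegenerate.1 v h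

theorem injective_of_form {T : V →ₗ[F] V} (hT : ∀ v w, D.form (T v) (T w) = D.form v w) :
    Function.Injective T := by
  rw [← LinearMap.ker_eq_bot, LinearMap.ker_eq_bot']
  intro v hv
  refine D.eq_zero_of_form_eq_zero fun w => ?_
  rw [← hT, hv, map_zero, LinearMap.zero_apply]

/-- An endomorphism that preserves the form is an element of the symplectic group. -/
theorem exists_mem_Sp_of_form {T : V →ₗ[F] V} (hT : ∀ v w, D.form (T v) (T w) = D.form v w) :
    ∃ e ∈ D.Sp, (e : V →ₗ[F] V) = T := by
  have : Module.Finite F V := Module.Finite.of_basis D.basis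
  refine ⟨LinearEquiv.ofInjectiveEndo T (D.injective_of_form hT), fun v w => ?_, ?_⟩
  · exact hT v w
  · ext v; rfl

theorem tau_form (i : ℕ) (v w : V) : D.form (D.tau i v) (D.tau i w) = D.form v w := by
  have hxx := fun k l => D.isotropic_X _ (D.x k).2 _ (D.x l).2
  have hyy := fun k l => D.isotropic_Y _ (D.y k).2 _ (D.y l).2
  refine D.form_map_eq_of_basis (fun k l => ?_) (fun k l => ?_) (fun k l => ?_) v w
  · rw [tau_x, tau_x]
    split_ifs with h1 h2 h2
    · simp [hyy]
    · have : l ≠ k := by rintro rfl; exact h2 h1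
      simp [form_y_x, this]
    · have : k ≠ l := by rintro rfl; exact h1 h2
      simp [D.dual, this]
    · exact hxx k l
  · rw [tau_y, tau_y]
    split_ifs with h1 h2 h2
    · exact hxx k l
    · have : k ≠ l := by rintro rfl; exact h2 h1
      simp [D.dual, this]
    · have : l ≠ k := by rintro rfl; exact h1 h2
      simp [form_y_x, this]
    · exact hyy k l
  · rw [tau_x, tau_y]
    rcases eq_or_ne k l with rfl | hkl
    · by_cases h : (k : ℕ) < i
      · simp [h, form_y_x]
      · simp [h, D.dual]
    · rw [if_neg hkl]
      split_ifs <;> simp [hxx, hyy, form_y_x, D.dual, hkl, hkl.symm]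

/-- `Y` is its own orthogonal complement. -/
theorem mem_Y_of_form_eq_zero {v : V} (h : ∀ y ∈ D.Y, D.form v y = 0) : v ∈ D.Y := by
  rw [← prX_eq_zero_iff]
  refine Subtype.ext (D.eq_zero_of_form_eq_zero fun w => ?_)
  rw [← D.prX_add_prY w, map_add, D.isotropic_X _ (D.prX v).2 _ (D.prX w).2, zero_add]
  have h1 := h _ (D.prY w).2
  rwa [← D.prX_add_prY v, map_add, LinearMap.add_apply,
    D.isotropic_Y _ (D.prY v).2 _ (D.prY w).2, add_zero] at h1

/-- The basis of `Y` dual to a basis of `X`. -/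
theorem exists_dual_basis (x' : Module.Basis (Fin D.n) F D.X) :
    ∃ w : Module.Basis (Fin D.n) F D.Y, ∀ i j, D.form (x' i) (w j) = if i = j then 1 else 0 := by
  have : Module.Finite F D.Y := Module.Finite.of_basis D.y
  -- Pairing with `x'` is injective on `Y` by nondegeneracy, hence bijective by dimension; `w` is
  -- the preimage of the standard basis.
  let f : D.Y →ₗ[F] (Fin D.n → F) := LinearMap.pi fun i => (D.form (x' i : V)) ∘ₗ D.Y.subtype
  have hf : Function.Injective f := by
    rw [← LinearMap.ker_eq_bot, LinearMap.ker_eq_bot']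
    intro y hy
    refine Subtype.ext (D.eq_zero_of_form_eq_zero fun v => ?_)
    rw [← D.prX_add_prY v, map_add, D.isotropic_Y _ y.2 _ (D.prY v).2, add_zero, ← D.alt.neg_eq,
      neg_eq_zero, ← x'.sum_repr (D.prX v)]
    simp only [Submodule.coe_sum, Submodule.coe_smul, map_sum, map_smul, LinearMap.sum_apply,
      LinearMap.smul_apply]
    exact Finset.sum_eq_zero fun i _ => by
      rw [show D.form (x' i : V) (y : V) = 0 from congrFun hy i, smul_zero]
  let e : D.Y ≃ₗ[F] (Fin D.n → F) := LinearEquiv.ofInjectiveOfFinrankEq f hf (by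
    rw [Module.finrank_eq_card_basis D.y, Module.finrank_fin_fun, Fintype.card_fin])
  refine ⟨Module.Basis.ofEquivFun e, fun i j => ?_⟩
  have h1 : f (Module.Basis.ofEquivFun e j) = Pi.single j 1 := by
    rw [Module.Basis.coe_ofEquivFun]
    exact e.apply_symm_apply _
  have h2 := congrFun h1 i
  rw [Pi.single_apply] at h2
  exact h2

/-- A basis of `X` whose first `rank c` elements are of the form `y c`. -/
theorem exists_basis_range_c (g : V →ₗ[F] V) :
    ∃ (x' : Module.Basis (Fin D.n) F D.X) (v : Fin D.n → D.Y),
      (∀ j : Fin D.n, (j : ℕ) < Module.finrank F (D.YQuot g) → x' j = D.c g (v j)) ∧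
      ∀ y : D.Y, D.c g y ∈ Submodule.span F
        (x' '' {j : Fin D.n | (j : ℕ) < Module.finrank F (D.YQuot g)}) := by
  have : Module.Finite F D.Y := Module.Finite.of_basis D.y
  have : Module.Finite F D.X := Module.Finite.of_basis D.x
  set i := Module.finrank F (D.YQuot g) with hi
  set R := LinearMap.range (D.c g) with hR
  have hiR : Module.finrank F R = i := (D.c g).quotKerEquivRange.finrank_eq.symm
  obtain ⟨R', hRR'⟩ := Submodule.exists_isCompl R
  have hn : i + Module.finrank F R' = D.n := by
    rw [← hiR, Submodule.finrank_add_eq_of_isCompl hRR', Module.finrank_eq_card_basis D.x,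
      Fintype.card_fin]
  let bR : Module.Basis (Fin i) F R := Module.finBasisOfFinrankEq F R hiR
  let bR' := Module.finBasis F R'
  -- The basis of the range of `c` takes the first `i` indices, as the convention for `tau`
  -- requires.
  let e : Fin i ⊕ Fin (Module.finrank F R') ≃ Fin D.n := finSumFinEquiv.trans (finCongr hn)
  let x' : Module.Basis (Fin D.n) F D.X :=
    ((bR.prod bR').map (Submodule.prodEquivOfIsCompl R R' hRR')).reindex e
  have hx' : ∀ k : Fin i, x' (e (Sum.inl k)) = (bR k : D.X) := by
    intro k
    simp [x']
  have he : ∀ k : Fin i, ((e (Sum.inl k) : Fin D.n) : ℕ) = k := fun k => by simp [e]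
  have hex : ∀ k : Fin i, ∃ a, D.c g a = bR k := fun k => (bR k).2
  choose v hv using hex
  refine ⟨x', fun j => if h : (j : ℕ) < i then v ⟨j, h⟩ else 0, ?_, ?_⟩
  · intro j hj
    simp only [dif_pos hj, hv, ← hx']
    congr 1
  · intro y
    have h1 := bR.sum_repr ⟨D.c g y, LinearMap.mem_range_self _ y⟩
    have h2 := congrArg (Subtype.val : R → D.X) h1
    rw [← show _ = D.c g y from h2, Submodule.coe_sum]
    refine Submodule.sum_mem _ fun k _ => Submodule.smul_mem _ _ (Submodule.subset_span ?_)
    exact ⟨e (Sum.inl k), by rw [Set.mem_ofPred_eq, he]; exact k.2, hx' k⟩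

/-- The Bruhat decomposition of the symplectic group with respect to `P`. -/
theorem exists_isFactorization (g : D.Sp) : ∃ p₁ p₂, D.IsFactorization g.1 p₁ p₂ := by
  have : Module.Finite F V := Module.Finite.of_basis D.basis
  obtain ⟨x', v, hv, hspan⟩ := D.exists_basis_range_c (g.1 : V →ₗ[F] V)
  obtain ⟨w, hw⟩ := D.exists_dual_basis x'
  have hg : ∀ v v', D.form (g.1 v) (g.1 v') = D.form v v' := g.2
  have hdec : ∀ z : D.Y,
      g.1 (z : V) = (D.c (g.1 : V →ₗ[F] V) z : V) + (D.d (g.1 : V →ₗ[F] V) z : V) :=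
    fun z => (D.prX_add_prY (g.1 (z : V))).symm
  unfold IsFactorization
  generalize hi : Module.finrank F (D.YQuot (g.1 : V →ₗ[F] V)) = i at hv hspan
  -- the `Y`-components of the new first basis vectors
  let e : Fin D.n → D.Y := fun l =>
    if (l : ℕ) < i then D.d (g.1 : V →ₗ[F] V) (v l)
    else ∑ k : Fin D.n, (if (k : ℕ) < i then D.form (x' l) (D.d (g.1 : V →ₗ[F] V) (v k)) else 0) • w k
  have hgv : ∀ l : Fin D.n, (l : ℕ) < i → g.1 (v l : V) = (x' l : V) + (e l : V) := by
    intro l hl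
    rw [hdec, ← hv l hl]
    simp only [e, if_pos hl]
  have hlt : ∀ k l : Fin D.n, (k : ℕ) < i → (l : ℕ) < i →
      D.form (x' k) (e l) = D.form (x' l) (e k) := by
    intro k l hk hl
    have h1 := hg (v k) (v l)
    rw [D.isotropic_Y _ (v k).2 _ (v l).2, hgv k hk, hgv l hl, map_add, map_add,
      LinearMap.add_apply, LinearMap.add_apply, D.isotropic_X _ (x' k).2 _ (x' l).2,
      D.isotropic_Y _ (e k).2 _ (e l).2, zero_add, add_zero] at h1
    linear_combination h1 + D.alt.neg_eq (e k : V) (x' l : V)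
  have hge : ∀ k l : Fin D.n, ¬ (l : ℕ) < i →
      D.form (x' k) (e l) = if (k : ℕ) < i then D.form (x' l) (e k) else 0 := by
    intro k l hl
    simp only [e, if_neg hl, Submodule.coe_sum, Submodule.coe_smul, map_sum, map_smul, hw]
    rw [Finset.sum_eq_single k (fun b _ hb => by rw [if_neg hb.symm, smul_zero]) (by simp)]
    by_cases hk : (k : ℕ) < i
    · simp [hk]
    · simp [hk]
  -- This symmetry says that the span of the vectors `x'_j + e_j` is isotropic. Below `i` it holds
  -- since `gY` is isotropic; the remaining `e_l` were chosen to enforce it.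
  have hsymm : ∀ k l : Fin D.n, D.form (x' k) (e l) = D.form (x' l) (e k) := by
    intro k l
    by_cases hk : (k : ℕ) < i <;> by_cases hl : (l : ℕ) < i
    · exact hlt k l hk hl
    · rw [hge k l hl, if_pos hk]
    · rw [hge l k hk, if_pos hl]
    · rw [hge k l hl, hge l k hk, if_neg hk, if_neg hl]
  -- For `j < i` this map sends `x_j`, which is the image of `y_j` under `tau`, to `g v_j`; so `tau`
  -- followed by it can carry `Y` onto `gY`.
  let T₂ : V →ₗ[F] V := D.basis.constr F (Sum.elim (fun j => (x' j : V) + (e j : V)) fun j => (w j : V))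
  have hT₂x : ∀ j, T₂ (D.x j : V) = (x' j : V) + (e j : V) := fun j => by
    rw [← basis_inl, Module.Basis.constr_basis, Sum.elim_inl]
  have hT₂y : ∀ j, T₂ (D.y j : V) = (w j : V) := fun j => by
    rw [← basis_inr, Module.Basis.constr_basis, Sum.elim_inr]
  have hT₂ : ∀ v v', D.form (T₂ v) (T₂ v') = D.form v v' := by
    refine D.form_map_eq_of_basis (fun k l => ?_) (fun k l => ?_) (fun k l => ?_)
    · rw [hT₂x, hT₂x, map_add, map_add, LinearMap.add_apply, LinearMap.add_apply,
        D.isotropic_X _ (x' k).2 _ (x' l).2, D.isotropic_Y _ (e k).2 _ (e l).2, hsymm k l]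
      linear_combination -D.alt.neg_eq (e k : V) (x' l : V)
    · rw [hT₂y, hT₂y, D.isotropic_Y _ (w k).2 _ (w l).2]
    · rw [hT₂x, hT₂y, map_add, LinearMap.add_apply, D.isotropic_Y _ (e k).2 _ (w l).2, add_zero, hw]
  obtain ⟨p₂, hp₂, hp₂T⟩ := D.exists_mem_Sp_of_form hT₂
  obtain ⟨t, ht, htT⟩ := D.exists_mem_Sp_of_form (D.tau_form i)
  have hmapY : ∀ {p : V ≃ₗ[F] V}, (∀ y ∈ D.Y, p y ∈ D.Y) → D.Y.map (p : V →ₗ[F] V) = D.Y := by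
    intro p hp
    refine Submodule.eq_of_le_of_finrank_eq ?_ (LinearEquiv.finrank_map_eq p D.Y)
    rintro _ ⟨y, hy, rfl⟩
    exact hp y hy
  -- For `k ≥ i`, `w_k` is orthogonal to the range of `c`, hence to `gY`. So `g⁻¹ w_k` is orthogonal
  -- to `Y`, which is its own orthogonal complement.
  have hwg : ∀ k : Fin D.n, ¬ (k : ℕ) < i → g.1.symm (w k : V) ∈ D.Y := by
    intro k hk
    refine D.mem_Y_of_form_eq_zero fun y hy => ?_
    rw [← hg, LinearEquiv.apply_symm_apply, ← D.alt.neg_eq, neg_eq_zero, hdec ⟨y, hy⟩, map_add,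
      LinearMap.add_apply, D.isotropic_Y _ (D.d _ _).2 _ (w k).2, add_zero]
    have h1 := hspan ⟨y, hy⟩
    generalize D.c (g.1 : V →ₗ[F] V) ⟨y, hy⟩ = z at h1
    induction h1 using Submodule.span_induction with
    | mem z hz =>
      obtain ⟨j, hj, rfl⟩ := hz
      rw [hw, if_neg]
      rintro rfl
      exact hk hj
    | zero => simp
    | add a b _ _ ha hb => rw [Submodule.coe_add, map_add, LinearMap.add_apply, ha, hb, add_zero]
    | smul a b _ hb => rw [Submodule.coe_smul, map_smul, LinearMap.smul_apply, hb, smul_zero]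
  -- `p₂ τ` maps `Y` into `g Y`
  have hTY : ∀ y : D.Y, g.1.symm (p₂ (t (y : V))) ∈ D.Y := by
    have hp₂' : ∀ u, p₂ u = T₂ u := fun u => LinearMap.congr_fun hp₂T u
    have ht' : ∀ u, t u = D.tau i u := fun u => LinearMap.congr_fun htT u
    have hj : ∀ j, g.1.symm (p₂ (t (D.y j : V))) ∈ D.Y := by
      intro j
      rw [ht', hp₂', tau_y]
      split_ifs with h
      · rw [hT₂x, ← hgv j h, LinearEquiv.symm_apply_apply]
        exact (v j).2
      · rw [hT₂y]
        exact hwg j h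
    intro y
    rw [← D.y.sum_repr y]
    simp only [Submodule.coe_sum, Submodule.coe_smul, map_sum, map_smul]
    exact Submodule.sum_mem _ fun j _ => Submodule.smul_mem _ _ (hj j)
  -- The factorization now holds by construction; only the invariance of `Y` under `p₁` and `p₂`
  -- remains.
  let p₁ : V ≃ₗ[F] V := g.1.trans (p₂.symm.trans t.symm)
  have hp₁ : p₁ ∈ D.Sp := D.Sp.mul_mem (D.Sp.mul_mem (D.Sp.inv_mem ht) (D.Sp.inv_mem hp₂)) g.2
  refine ⟨p₁, p₂, ⟨hp₁, hmapY fun y hy => ?_⟩, ⟨hp₂, hmapY fun y hy => ?_⟩, ?_⟩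
  · refine D.mem_Y_of_form_eq_zero fun y' hy' => ?_
    have h1 : p₂ (t (p₁ y)) = g.1 y := by simp [p₁]
    rw [← ht, ← hp₂, h1, ← LinearEquiv.apply_symm_apply g.1 (p₂ (t y')), hg]
    exact D.isotropic_Y _ hy _ (hTY ⟨y', hy'⟩)
  · have hp₂' : ∀ u, p₂ u = T₂ u := fun u => LinearMap.congr_fun hp₂T u
    have h1 : ∀ y : D.Y, p₂ (y : V) ∈ D.Y := by
      intro y
      rw [← D.y.sum_repr y]
      simp only [Submodule.coe_sum, Submodule.coe_smul, map_sum, map_smul, hp₂', hT₂y]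
      exact Submodule.sum_mem _ fun j _ => Submodule.smul_mem _ _ (w j).2
    exact h1 ⟨y, hy⟩
  · rw [← htT]
    ext u
    simp [p₁]

end Factorization

end Polarization

end LocalWeil

end

noncomputable section

namespace LocalWeil

/-! ### Rationality of measures of compact open sets in `F^I`. -/

section PiMeasure

open Topology Pointwise

variable {F : Type*} [Field F] [ValuativeRel F] [TopologicalSpace F]
  [IsNonarchimedeanLocalField F] [MeasurableSpace F] [BorelSpace F]

/-- The measure of a compact open subset of `F ^ I` is a rational number times a power of the
measure of the ring of integers. -/
theorem measureReal_pi_mem {I : Type*} [Fintype I] (m : Measure F) [m.IsAddHaarMeasure]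
    {K : IntermediateField ℚ ℂ} (hK : (m.real (lattice (1 : F)) : ℂ) ∈ K) {U : Set (I → F)}
    (hU : IsCompact U) (hUo : IsOpen U) : ((Measure.pi fun _ : I => m).real U : ℂ) ∈ K := by
  -- `U` is stable under translation by a small `(c𝒪)^I`, so its measure is a natural number times
  -- that of this subgroup.
  obtain ⟨V, hV, hUV⟩ := compact_open_separated_add_right hU hUo subset_rfl
  rw [nhds_pi, Filter.mem_pi'] at hV
  obtain ⟨J, t, ht, htV⟩ := hV
  have hW : ⋂ i, t i ∈ 𝓝 (0 : F) := Filter.iInter_mem.2 ht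
  obtain ⟨c, hc, hcW⟩ := exists_lattice_subset hW
  let H : AddSubgroup (I → F) := AddSubgroup.pi Set.univ fun _ => lattice c
  have hHcoe : (H : Set (I → F)) = Set.univ.pi fun _ => (lattice c : Set F) := by
    ext x; simp [H, AddSubgroup.mem_pi]
  have hH : IsOpen (H : Set (I → F)) := by
    rw [hHcoe]
    exact isOpen_set_pi Set.finite_univ fun _ _ => isOpen_lattice hc
  obtain ⟨N, hN⟩ := exists_measure_eq_natCast_mul (Measure.pi fun _ : I => m) H hH hU
    (fun x hx h hh => hUV (Set.add_mem_add hx (htV fun i _ => by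
      rw [← SetLike.mem_coe, hHcoe] at hh
      exact Set.mem_iInter.1 (hcW (hh i trivial)) i)))
  obtain ⟨k, hk⟩ := exists_measure_lattice_eq m hc
  have h1 : (Measure.pi fun _ : I => m).real U =
      N * ((resCard F : ℝ) ^ k * m.real (lattice (1 : F))) ^ Fintype.card I := by
    rw [← hk, measureReal_def, hN, hHcoe, Measure.pi_pi, ENNReal.toReal_mul, ENNReal.toReal_prod]
    simp [measureReal_def]
  rw [h1]
  push_cast
  exact mul_mem (natCast_mem K N) (pow_mem (mul_mem (zpow_mem (natCast_mem K _) k) hK) _)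

end PiMeasure

/-- The identity of `W` factors through the projection of `V` along `W'`, which is linear and so
continuous into the module topology. With this, linear maps between `X`, `Y` and their quotients are
continuous automatically. -/
theorem isModuleTopology_of_isCompl {F V : Type*} [Field F] [TopologicalSpace F]
    [IsTopologicalRing F] [AddCommGroup V] [Module F V] [TopologicalSpace V] [IsModuleTopology F V]
    {W W' : Submodule F V} (h : IsCompl W W') : IsModuleTopology F W := by
  have := IsModuleTopology.topologicalAddGroup F V
  refine IsModuleTopology.of_continuous_id ?_
  have h1 : @Continuous V W _ (moduleTopology F W) (W.projectionOnto W' h) := by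
    let : TopologicalSpace W := moduleTopology F W
    have : IsModuleTopology F W := ⟨rfl⟩
    have := IsModuleTopology.toContinuousAdd F W
    exact IsModuleTopology.continuous_of_linearMap _
  have h2 : (id : W → W) = fun w : W => W.projectionOnto W' h (w : V) := by
    funext w; simp
  rw [h2]
  exact @Continuous.comp _ _ _ _ _ (moduleTopology F W) _ _ h1 continuous_subtype_val

/-- A linear equivalence of modules with the module topology is bicontinuous. -/
def moduleTopologyEquiv {F A B : Type*} [Field F] [TopologicalSpace F]
    [IsTopologicalRing F] [AddCommGroup A] [Module F A] [TopologicalSpace A] [IsModuleTopology F A]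
    [AddCommGroup B] [Module F B] [TopologicalSpace B] [IsModuleTopology F B] (e : A ≃ₗ[F] B) :
    A ≃L[F] B where
  toLinearEquiv := e
  continuous_toFun := by
    have := IsModuleTopology.toContinuousAdd F B
    exact IsModuleTopology.continuous_of_linearMap (e : A →ₗ[F] B)
  continuous_invFun := by
    have := IsModuleTopology.toContinuousAdd F A
    exact IsModuleTopology.continuous_of_linearMap (e.symm : B →ₗ[F] A)

/-! ### Linear coordinates on `Y_g` and the measure on it. -/

namespace Polarization

variable {F V : Type*} [Field F] [AddCommGroup V] [Module F V] (D : Polarization F V)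

theorem c_tau_y (i : ℕ) (j : Fin D.n) :
    D.c (D.tau i) (D.y j) = if (j : ℕ) < i then D.x j else 0 := by
  change D.prX (D.tau i (D.y j : V)) = _
  rw [tau_y]
  split_ifs
  · simp [prX]
  · rw [prX_eq_zero_iff]; exact (D.y j).2

/-- The coordinates on `Y_{τ_i}`. -/
def tauCoord (i : ℕ) : ({k : Fin D.n // (k : ℕ) < i} → F) →ₗ[F] D.YQuot (D.tau i) :=
  (LinearMap.ker (D.c (D.tau i))).mkQ ∘ₗ Fintype.linearCombination F fun k => D.y k.1

theorem tauCoord_apply (i : ℕ) (t : {k : Fin D.n // (k : ℕ) < i} → F) :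
    D.tauCoord i t = Submodule.Quotient.mk (∑ k, t k • D.y k.1) := rfl

/-- The block `c` of `τ_i` sends `y_k` to `x_k` for the first `i` indices and kills the other `y_k`,
which therefore span its kernel. -/
theorem tauCoord_bijective (i : ℕ) : Function.Bijective (D.tauCoord i) := by
  constructor
  · rw [← LinearMap.ker_eq_bot, LinearMap.ker_eq_bot']
    intro t ht
    rw [tauCoord_apply, Submodule.Quotient.mk_eq_zero, LinearMap.mem_ker, map_sum] at ht
    have h1 : ∑ k : {k : Fin D.n // (k : ℕ) < i}, t k • D.x k.1 = 0 := by
      rw [← ht]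
      refine Finset.sum_congr rfl fun k _ => ?_
      rw [map_smul, c_tau_y, if_pos k.2]
    have h2 : LinearIndependent F fun k : {k : Fin D.n // (k : ℕ) < i} => D.x k.1 :=
      D.x.linearIndependent.comp _ Subtype.val_injective
    funext k
    exact Fintype.linearIndependent_iff.1 h2 t h1 k
  · intro z
    obtain ⟨w, rfl⟩ := Submodule.Quotient.mk_surjective _ z
    refine ⟨fun k => D.y.repr w k.1, ?_⟩
    rw [tauCoord_apply, Submodule.Quotient.eq, LinearMap.mem_ker, map_sub, sub_eq_zero, map_sum]
    conv_rhs => rw [← D.y.sum_repr w, map_sum]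
    simp_rw [map_smul, c_tau_y, smul_ite, smul_zero]
    refine (Finset.sum_congr rfl fun k _ => if_pos k.2).trans ?_
    rw [← Finset.sum_filter]
    exact (Finset.sum_subtype (Finset.univ.filter fun k : Fin D.n => (k : ℕ) < i) (by simp)
      fun k => D.y.repr w k • D.x k).symm

variable {D} in
theorem IsFactorization.d_apply {g p₁ p₂ : V ≃ₗ[F] V} (h : D.IsFactorization g p₁ p₂) (y : D.Y) :
    ((D.d (p₁ : V →ₗ[F] V) y : D.Y) : V) = p₁ y := by
  have hm : p₁ (y : V) ∈ D.Y := by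
    have h0 : (p₁ : V →ₗ[F] V) (y : V) ∈ D.Y.map (p₁ : V →ₗ[F] V) := ⟨y, y.2, rfl⟩
    rwa [h.1.2] at h0
  have h3 := D.prX_add_prY (p₁ (y : V))
  rwa [(D.prX_eq_zero_iff _).2 hm, Submodule.coe_zero, zero_add] at h3

variable {D} in
theorem IsFactorization.tau_mem_iff {g p₁ p₂ : V ≃ₗ[F] V} (h : D.IsFactorization g p₁ p₂) (v : V) :
    D.tau (Module.finrank F (D.YQuot (g : V →ₗ[F] V))) (p₁ v) ∈ D.Y ↔ g v ∈ D.Y := by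
  obtain ⟨-, h₂, hg⟩ := h
  generalize D.tau (Module.finrank F (D.YQuot (g : V →ₗ[F] V))) = T at hg ⊢
  have h4 : g v = p₂ (T (p₁ v)) := congrArg (fun f : V →ₗ[F] V => f v) hg
  rw [h4]
  conv_rhs => rw [← h₂.2]
  exact ⟨fun h => ⟨_, h, rfl⟩, fun ⟨z, hz, hzz⟩ => p₂.injective hzz ▸ hz⟩

theorem mem_ker_c_iff (g : V →ₗ[F] V) (y : D.Y) : y ∈ LinearMap.ker (D.c g) ↔ g (y : V) ∈ D.Y :=
  D.prX_eq_zero_iff _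

/-- Since `p₂` preserves `Y`, `gy ∈ Y` exactly when `τ_i(p₁ y) ∈ Y`, which gives injectivity;
surjectivity is `p₁ Y = Y`. -/
theorem pBar_bijective {g p₁ p₂ : V ≃ₗ[F] V} (h : D.IsFactorization g p₁ p₂) :
    Function.Bijective (D.pBar h) := by
  constructor
  · rw [← LinearMap.ker_eq_bot, LinearMap.ker_eq_bot']
    intro z hz
    obtain ⟨y, rfl⟩ := Submodule.Quotient.mk_surjective _ z
    rw [pBar, Submodule.mapQ_apply, Submodule.Quotient.mk_eq_zero, mem_ker_c_iff, h.d_apply] at hz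
    rw [Submodule.Quotient.mk_eq_zero, mem_ker_c_iff]
    exact (h.tau_mem_iff _).1 hz
  · intro z
    obtain ⟨w, rfl⟩ := Submodule.Quotient.mk_surjective _ z
    have hw : (w : V) ∈ D.Y.map (p₁ : V →ₗ[F] V) := by rw [h.1.2]; exact w.2
    obtain ⟨y, hy, hyw⟩ := hw
    refine ⟨Submodule.Quotient.mk ⟨y, hy⟩, ?_⟩
    rw [pBar, Submodule.mapQ_apply]
    congr 1
    exact Subtype.ext ((h.d_apply _).trans hyw)

section Topology

variable [ValuativeRel F] [TopologicalSpace F] [IsNonarchimedeanLocalField F]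
  [TopologicalSpace V] [IsModuleTopology F V]

instance : IsModuleTopology F D.X := isModuleTopology_of_isCompl D.isCompl
instance : IsModuleTopology F D.Y := isModuleTopology_of_isCompl D.isCompl.symm

instance (g : V →ₗ[F] V) : BorelSpace (D.YQuot g) := ⟨rfl⟩

variable [MeasurableSpace F] [BorelSpace F]

/-- `μ_{lam,g}` is a multiple of the product measure for suitable linear coordinates of `Y_g`. -/
theorem mu_eq_smul_map (lam : AddChar F Circle) (g p₁ p₂ : V ≃ₗ[F] V)
    (h : D.IsFactorization g p₁ p₂) :
    ∃ (x : F) (e : ({k : Fin D.n // (k : ℕ) < Module.finrank F (D.YQuot (g : V →ₗ[F] V))} → F) ≃L[F]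
        D.YQuot (g : V →ₗ[F] V)),
      D.mu lam g = ENNReal.ofReal (absF x ^ (-1 / 2 : ℝ)) •
        (Measure.pi fun _ => selfDual lam).map e := by
  -- `mu` uses a factorization of its own choice; the given one only shows that the default `0` does
  -- not occur.
  have hex : ∃ p : (V ≃ₗ[F] V) × (V ≃ₗ[F] V), D.IsFactorization g p.1 p.2 := ⟨(p₁, p₂), h⟩
  rw [mu, dif_pos hex]
  let i := Module.finrank F (D.YQuot (g : V →ₗ[F] V))
  let e₁ := moduleTopologyEquiv (LinearEquiv.ofBijective _ (D.tauCoord_bijective i))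
  let e₂ := moduleTopologyEquiv (LinearEquiv.ofBijective _ (D.pBar_bijective hex.choose_spec))
  refine ⟨LinearMap.det (D.d ((hex.choose.2 : V →ₗ[F] V) ∘ₗ (hex.choose.1 : V →ₗ[F] V))),
    e₁.trans e₂.symm, ?_⟩
  congr 1
  have h1 : (D.pBar hex.choose_spec : _ → _) = e₂.toHomeomorph.toMeasurableEquiv := rfl
  have h2 : D.muTau lam i = (Measure.pi fun _ => selfDual lam).map e₁ := rfl
  rw [h1, h2, ← MeasurableEquiv.map_symm, Measure.map_map]
  · rfl
  · exact e₂.toHomeomorph.toMeasurableEquiv.symm.measurable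
  · exact e₁.continuous.measurable

theorem absF_rpow_mem (x : F) {K : IntermediateField ℚ ℂ}
    (hK : ((√(resCard F : ℝ) : ℝ) : ℂ) ∈ K) : ((absF x ^ (-1 / 2 : ℝ) : ℝ) : ℂ) ∈ K := by
  rw [absF]
  split_ifs
  -- At `x = 0` the value is `0`, by the convention for real powers of `0`; elsewhere it is an
  -- integral power of `√q`.
  · rw [Real.zero_rpow (by norm_num), Complex.ofReal_zero]
    exact K.zero_mem
  · generalize
      WithZero.log (IsNonarchimedeanLocalField.valueGroupWithZeroIsoInt F (valuation F x)) = k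
    have h1 : ((resCard F : ℝ) ^ k) ^ (-1 / 2 : ℝ) = √(resCard F : ℝ) ^ (-k) := by
      rw [Real.sqrt_eq_rpow, ← Real.rpow_intCast, ← Real.rpow_intCast,
        ← Real.rpow_mul (by positivity), ← Real.rpow_mul (by positivity)]
      congr 1
      push_cast
      ring
    rw [h1]
    push_cast
    exact zpow_mem hK _

theorem measureReal_lattice_one_mem {lam : AddChar F Circle} (hlam : Continuous lam)
    (hlam1 : lam ≠ 1) {K : IntermediateField ℚ ℂ} (hK : ((√(resCard F : ℝ) : ℝ) : ℂ) ∈ K) :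
    ((selfDual lam).real (lattice (1 : F)) : ℂ) ∈ K := by
  obtain ⟨k, hk⟩ := (isSelfDual_selfDual hlam hlam1).measure_lattice_sq hlam hlam1
  have h1 : (selfDual lam).real (lattice (1 : F)) = √(resCard F : ℝ) ^ k := by
    rw [← sq_eq_sq₀ measureReal_nonneg (by positivity), hk, ← zpow_natCast, ← zpow_mul, mul_comm,
      zpow_mul, zpow_natCast, Real.sq_sqrt (by positivity)]
  rw [h1]
  push_cast
  exact zpow_mem hK _

variable {lam : AddChar F Circle} (hlam : Continuous lam) (hlam1 : lam ≠ 1) (g : D.Sp)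

include hlam hlam1 in
/-- The basic properties of `μ_{lam,g}`. -/
theorem mu_spec :
    (D.mu lam g.1).IsAddLeftInvariant ∧
      (∀ U, IsCompact U → IsOpen U → D.mu lam g.1 U ≠ ⊤) ∧
      ∀ K : IntermediateField ℚ ℂ, ((√(resCard F : ℝ) : ℝ) : ℂ) ∈ K →
        ∀ U, IsCompact U → IsOpen U → ((D.mu lam g.1).real U : ℂ) ∈ K := by
  have := (isSelfDual_selfDual hlam hlam1).1
  obtain ⟨p₁, p₂, h⟩ := D.exists_isFactorization g
  obtain ⟨x, e, he⟩ := D.mu_eq_smul_map lam g.1 p₁ p₂ h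
  rw [he]
  have happ : ∀ U, IsOpen U → (Measure.pi fun _ => selfDual lam).map e U =
      (Measure.pi fun _ => selfDual lam) (e ⁻¹' U) := fun U hU =>
    Measure.map_apply e.continuous.measurable hU.measurableSet
  have hpre : ∀ U, IsCompact U → IsCompact (e ⁻¹' U) := fun U hU =>
    e.toHomeomorph.isCompact_preimage.2 hU
  refine ⟨?_, fun U hU hUo => ?_, fun K hK U hU hUo => ?_⟩
  · have := IsModuleTopology.topologicalAddGroup F (D.YQuot (g.1 : V →ₗ[F] V))
    have h1 : ((Measure.pi fun _ => selfDual lam).map e).IsAddLeftInvariant :=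
      isAddLeftInvariant_map e.toLinearEquiv.toAddEquiv.toAddMonoidHom.toAddHom e.continuous.measurable e.surjective
    infer_instance
  · rw [Measure.smul_apply, happ U hUo, smul_eq_mul]
    exact ENNReal.mul_ne_top ENNReal.ofReal_ne_top (hpre U hU).measure_ne_top
  · rw [measureReal_ennreal_smul_apply, ENNReal.toReal_ofReal, measureReal_def, happ U hUo]
    · push_cast
      exact mul_mem (absF_rpow_mem x hK) (measureReal_pi_mem _
        (measureReal_lattice_one_mem hlam hlam1 hK) (hpre U hU) (hUo.preimage e.continuous))
    · refine Real.rpow_nonneg ?_ _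
      rw [absF]
      split_ifs <;> positivity

omit [BorelSpace F] [IsModuleTopology F V] in
-- The character enters `mu` only through its self-dual measure; the factorization of `g` is chosen
-- independently of it.
theorem mu_congr {lam' : AddChar F Circle} (h : selfDual lam' = selfDual lam) :
    D.mu lam' g.1 = D.mu lam g.1 := by
  simp only [mu, muTau, h]

end Topology

end Polarization

end LocalWeil

end

noncomputable section

namespace LocalWeil

namespace Polarization

open Topology

/-! ### Symplectic block identities and translations of the integrand. -/

section Identities

variable {F V : Type*} [Field F] [AddCommGroup V] [Module F V] (D : Polarization F V)

theorem apply_eq_a_add_b (g : V →ₗ[F] V) (x : D.X) : g (x : V) = (D.a g x : V) + (D.b g x : V) :=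
  (D.prX_add_prY _).symm

theorem apply_eq_c_add_d (g : V →ₗ[F] V) (y : D.Y) : g (y : V) = (D.c g y : V) + (D.d g y : V) :=
  (D.prX_add_prY _).symm

variable (g : D.Sp)

/-- This expresses that `gX` is isotropic. The next two identities likewise expand the invariance of
the form on `Y × Y` and on `X × Y`. -/
theorem form_a_b_comm (x h : D.X) :
    D.form (D.a (g.1 : V →ₗ[F] V) h) (D.b (g.1 : V →ₗ[F] V) x) =
      D.form (D.a (g.1 : V →ₗ[F] V) x) (D.b (g.1 : V →ₗ[F] V) h) := by
  have h1 := g.2 (x : V) (h : V)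
  have e : ∀ z : D.X, g.1 (z : V) = _ := D.apply_eq_a_add_b (g.1 : V →ₗ[F] V)
  rw [D.isotropic_X _ x.2 _ h.2, e, e, map_add, map_add, LinearMap.add_apply, LinearMap.add_apply,
    D.isotropic_X _ (D.a _ x).2 _ (D.a _ h).2, D.isotropic_Y _ (D.b _ x).2 _ (D.b _ h).2,
    add_zero, zero_add] at h1
  linear_combination -h1 - D.alt.neg_eq (D.b (g.1 : V →ₗ[F] V) x : V) (D.a (g.1 : V →ₗ[F] V) h : V)

theorem form_c_d_comm (y y₀ : D.Y) :
    D.form (D.c (g.1 : V →ₗ[F] V) y₀) (D.d (g.1 : V →ₗ[F] V) y) =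
      D.form (D.c (g.1 : V →ₗ[F] V) y) (D.d (g.1 : V →ₗ[F] V) y₀) := by
  have h1 := g.2 (y : V) (y₀ : V)
  have e : ∀ z : D.Y, g.1 (z : V) = _ := D.apply_eq_c_add_d (g.1 : V →ₗ[F] V)
  rw [D.isotropic_Y _ y.2 _ y₀.2, e, e, map_add, map_add, LinearMap.add_apply, LinearMap.add_apply,
    D.isotropic_X _ (D.c _ y).2 _ (D.c _ y₀).2, D.isotropic_Y _ (D.d _ y).2 _ (D.d _ y₀).2,
    add_zero, zero_add] at h1
  linear_combination -h1 - D.alt.neg_eq (D.d (g.1 : V →ₗ[F] V) y : V) (D.c (g.1 : V →ₗ[F] V) y₀ : V)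

theorem form_a_d_add_form_b_c (x : D.X) (y : D.Y) :
    D.form (D.a (g.1 : V →ₗ[F] V) x) (D.d (g.1 : V →ₗ[F] V) y) +
      D.form (D.b (g.1 : V →ₗ[F] V) x) (D.c (g.1 : V →ₗ[F] V) y) = D.form x y := by
  have h1 := g.2 (x : V) (y : V)
  have e : ∀ z : D.X, g.1 (z : V) = _ := D.apply_eq_a_add_b (g.1 : V →ₗ[F] V)
  have e' : ∀ z : D.Y, g.1 (z : V) = _ := D.apply_eq_c_add_d (g.1 : V →ₗ[F] V)
  rw [e, e', map_add, map_add, LinearMap.add_apply, LinearMap.add_apply,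
    D.isotropic_X _ (D.a _ x).2 _ (D.c _ y).2, D.isotropic_Y _ (D.b _ x).2 _ (D.d _ y).2] at h1
  linear_combination h1

/-- The effect on the integrand of a translation in `X`. -/
theorem integrand_add_left (h2 : (2 : F) ≠ 0) (lam : AddChar F Circle) {φ : D.X → ℂ} {h : D.X}
    (hφ : ∀ z, φ (z + D.a (g.1 : V →ₗ[F] V) h) = φ z)
    (hlam : ∀ z, φ z ≠ 0 → lam (D.form z (D.b (g.1 : V →ₗ[F] V) h) +
      D.form (D.a (g.1 : V →ₗ[F] V) h) (D.b (g.1 : V →ₗ[F] V) h) / 2) = 1) (x : D.X) (y : D.Y) :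
    D.integrand lam g.1 φ (x + h) y = D.integrand lam g.1 φ x y := by
  unfold integrand
  rw [map_add (D.a _), add_right_comm, hφ]
  by_cases hz : φ (D.a (g.1 : V →ₗ[F] V) x + D.c (g.1 : V →ₗ[F] V) y) = 0
  · rw [hz, mul_zero, mul_zero]
  -- The change of the phase depends on `x` and `y` only through `z = xa + yc`, the argument of `φ`.
  · have h3 : (D.form (D.a (g.1 : V →ₗ[F] V) (x + h)) (D.b (g.1 : V →ₗ[F] V) (x + h)) -
        2 * D.form (D.b (g.1 : V →ₗ[F] V) (x + h)) (D.c (g.1 : V →ₗ[F] V) y) +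
        D.form (D.c (g.1 : V →ₗ[F] V) y) (D.d (g.1 : V →ₗ[F] V) y)) / 2 =
      (D.form (D.a (g.1 : V →ₗ[F] V) x) (D.b (g.1 : V →ₗ[F] V) x) -
        2 * D.form (D.b (g.1 : V →ₗ[F] V) x) (D.c (g.1 : V →ₗ[F] V) y) +
        D.form (D.c (g.1 : V →ₗ[F] V) y) (D.d (g.1 : V →ₗ[F] V) y)) / 2 +
      (D.form ((D.a (g.1 : V →ₗ[F] V) x + D.c (g.1 : V →ₗ[F] V) y : D.X) : V)
          (D.b (g.1 : V →ₗ[F] V) h) +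
        D.form (D.a (g.1 : V →ₗ[F] V) h) (D.b (g.1 : V →ₗ[F] V) h) / 2) := by
      simp only [Submodule.coe_add, map_add, LinearMap.add_apply]
      rw [D.form_a_b_comm g x h,
        ← D.alt.neg_eq (D.c (g.1 : V →ₗ[F] V) y : V) (D.b (g.1 : V →ₗ[F] V) h : V)]
      field_simp
      ring
    rw [← map_add (D.a _), h3, AddChar.map_add_eq_mul, hlam _ hz, mul_one]

/-- The effect on the integrand of a translation in `Y`. -/
theorem integrand_add_right (h2 : (2 : F) ≠ 0) (lam : AddChar F Circle) {φ : D.X → ℂ} {y₀ : D.Y}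
    (hφ : ∀ z, φ (z + D.c (g.1 : V →ₗ[F] V) y₀) = φ z)
    (hlam : ∀ z, φ z ≠ 0 → lam (D.form z (D.d (g.1 : V →ₗ[F] V) y₀) +
      D.form (D.c (g.1 : V →ₗ[F] V) y₀) (D.d (g.1 : V →ₗ[F] V) y₀) / 2) = 1) (x : D.X) (y : D.Y) :
    D.integrand lam g.1 φ x (y + y₀) = lam (-D.form x y₀) * D.integrand lam g.1 φ x y := by
  unfold integrand
  rw [map_add (D.c _), ← add_assoc, hφ]
  by_cases hz : φ (D.a (g.1 : V →ₗ[F] V) x + D.c (g.1 : V →ₗ[F] V) y) = 0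
  · rw [hz, mul_zero, mul_zero, mul_zero]
  -- Again the change depends on `z = xa + yc`, except for the term `-⟨x, y₀⟩` that comes from the
  -- identity on `X × Y`.
  · have h3 : (D.form (D.a (g.1 : V →ₗ[F] V) x) (D.b (g.1 : V →ₗ[F] V) x) -
        2 * D.form (D.b (g.1 : V →ₗ[F] V) x) (D.c (g.1 : V →ₗ[F] V) (y + y₀)) +
        D.form (D.c (g.1 : V →ₗ[F] V) (y + y₀)) (D.d (g.1 : V →ₗ[F] V) (y + y₀))) / 2 =
      -D.form x y₀ + (D.form (D.a (g.1 : V →ₗ[F] V) x) (D.b (g.1 : V →ₗ[F] V) x) -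
        2 * D.form (D.b (g.1 : V →ₗ[F] V) x) (D.c (g.1 : V →ₗ[F] V) y) +
        D.form (D.c (g.1 : V →ₗ[F] V) y) (D.d (g.1 : V →ₗ[F] V) y)) / 2 +
      (D.form ((D.a (g.1 : V →ₗ[F] V) x + D.c (g.1 : V →ₗ[F] V) y : D.X) : V)
          (D.d (g.1 : V →ₗ[F] V) y₀) +
        D.form (D.c (g.1 : V →ₗ[F] V) y₀) (D.d (g.1 : V →ₗ[F] V) y₀) / 2) := by
      simp only [Submodule.coe_add, map_add, LinearMap.add_apply]
      rw [D.form_c_d_comm g y y₀, ← D.form_a_d_add_form_b_c g x y₀]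
      field_simp
      ring
    rw [← map_add (D.c _), h3, AddChar.map_add_eq_mul, hlam _ hz, mul_one,
      AddChar.map_add_eq_mul, Circle.coe_mul, mul_assoc]

end Identities

/-! ### Small translations, uniformly in both variables. -/

section Weil

variable {F V : Type*} [Field F] [ValuativeRel F] [TopologicalSpace F]
  [IsNonarchimedeanLocalField F] [AddCommGroup V] [Module F V]
  [TopologicalSpace V] [IsModuleTopology F V] (D : Polarization F V)

theorem two_ne_zero_of_resChar_ne_two (hp : resChar F ≠ 2) : (2 : F) ≠ 0 := by
  intro h
  have h1 : (2 : 𝒪[F]) = 0 := Subtype.ext h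
  have h2 : ((2 : ℕ) : 𝓀[F]) = 0 := by
    have := congrArg (IsLocalRing.residue 𝒪[F]) h1
    rw [map_zero] at this
    exact_mod_cast this
  have h3 := (ringChar.spec 𝓀[F] 2).1 h2
  exact hp ((Nat.prime_dvd_prime_iff_eq resChar_prime Nat.prime_two).1 h3)

theorem continuous_form : Continuous fun p : V × V => D.form p.1 p.2 := by
  have : Module.Finite F V := Module.Finite.of_basis D.basis
  exact IsModuleTopology.continuous_bilinear_of_finite_left D.form

theorem continuous_linearMap {A B : Type*} [AddCommGroup A] [Module F A] [TopologicalSpace A]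
    [IsModuleTopology F A] [AddCommGroup B] [Module F B] [TopologicalSpace B] [IsModuleTopology F B]
    (f : A →ₗ[F] B) : Continuous f := by
  have := IsModuleTopology.toContinuousAdd F B
  exact IsModuleTopology.continuous_of_linearMap f

/-- A family of continuous functions that vanish at `0` is in the kernel of `lam` near `0`,
uniformly on compact sets. -/
theorem exists_nhds_addChar_eq_one {lam : AddChar F Circle} (hlam : Continuous lam)
    {A B : Type*} [TopologicalSpace A] [TopologicalSpace B] [Zero B] {Φ : A → B → F}
    (hΦ : Continuous fun p : A × B => Φ p.1 p.2) (h0 : ∀ z, Φ z 0 = 0) {S : Set A}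
    (hS : IsCompact S) : ∃ N ∈ 𝓝 (0 : B), ∀ h ∈ N, ∀ z ∈ S, lam (Φ z h) = 1 := by
  have hopen : IsOpen ((fun p : A × B => Φ p.1 p.2) ⁻¹' (lam ⁻¹' {1})) :=
    (isLocallyConstant_addChar hlam {1}).preimage hΦ
  obtain ⟨U, N, -, hN, hU, h0N, hUN⟩ := generalized_tube_lemma hS
    (isCompact_singleton (x := (0 : B))) hopen (by
      rintro ⟨a, b⟩ ⟨-, rfl⟩
      simp [h0])
  exact ⟨N, hN.mem_nhds (h0N rfl), fun h hh z hz => hUN (Set.mk_mem_prod (hU hz) hh)⟩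

variable (g : D.Sp) {lam : AddChar F Circle} (hlam : Continuous lam) {φ : D.X → ℂ}
  (hφ : φ ∈ schwartz D.X ℂ)

include hlam hφ

/-- One neighbourhood serves all `x` and `y`, because the change of phase matters only where `xa +
yc` lies in the compact support of `φ`. -/
theorem exists_nhds_integrand_add_left (h2 : (2 : F) ≠ 0) :
    ∃ N ∈ 𝓝 (0 : D.X), ∀ h ∈ N, ∀ x y,
      D.integrand lam g.1 φ (x + h) y = D.integrand lam g.1 φ x y := by
  have := IsModuleTopology.topologicalAddGroup F D.X
  obtain ⟨N₁, hN₁, h₁⟩ := exists_nhds_forall_add_eq hφ.1 hφ.2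
  have ha : Continuous (D.a (g.1 : V →ₗ[F] V)) := continuous_linearMap _
  have hb : Continuous (D.b (g.1 : V →ₗ[F] V)) := continuous_linearMap _
  obtain ⟨N₂, hN₂, h₂⟩ := exists_nhds_addChar_eq_one hlam (A := D.X) (B := D.X)
    (Φ := fun z h => D.form z (D.b (g.1 : V →ₗ[F] V) h) +
      D.form (D.a (g.1 : V →ₗ[F] V) h) (D.b (g.1 : V →ₗ[F] V) h) / 2)
    (((D.continuous_form.comp ((continuous_subtype_val.comp continuous_fst).prodMk
      (continuous_subtype_val.comp (hb.comp continuous_snd))))).add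
      ((D.continuous_form.comp ((continuous_subtype_val.comp (ha.comp continuous_snd)).prodMk
      (continuous_subtype_val.comp (hb.comp continuous_snd)))).div_const 2))
    (by simp) hφ.2.isCompact
  refine ⟨D.a (g.1 : V →ₗ[F] V) ⁻¹' N₁ ∩ N₂, Filter.inter_mem
    (ha.tendsto' 0 0 (map_zero _) hN₁) hN₂, fun h hh x y => ?_⟩
  exact D.integrand_add_left g h2 lam (h₁ _ hh.1)
    (fun z hz => h₂ h hh.2 z (subset_tsupport _ hz)) x y

theorem exists_nhds_integrand_add_right (h2 : (2 : F) ≠ 0) :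
    ∃ N ∈ 𝓝 (0 : D.Y), ∀ y₀ ∈ N, ∀ x y,
      D.integrand lam g.1 φ x (y + y₀) = lam (-D.form x y₀) * D.integrand lam g.1 φ x y := by
  have := IsModuleTopology.topologicalAddGroup F D.X
  obtain ⟨N₁, hN₁, h₁⟩ := exists_nhds_forall_add_eq hφ.1 hφ.2
  have hc : Continuous (D.c (g.1 : V →ₗ[F] V)) := continuous_linearMap _
  have hd : Continuous (D.d (g.1 : V →ₗ[F] V)) := continuous_linearMap _
  obtain ⟨N₂, hN₂, h₂⟩ := exists_nhds_addChar_eq_one hlam (A := D.X) (B := D.Y)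
    (Φ := fun z y₀ => D.form z (D.d (g.1 : V →ₗ[F] V) y₀) +
      D.form (D.c (g.1 : V →ₗ[F] V) y₀) (D.d (g.1 : V →ₗ[F] V) y₀) / 2)
    (((D.continuous_form.comp ((continuous_subtype_val.comp continuous_fst).prodMk
      (continuous_subtype_val.comp (hd.comp continuous_snd))))).add
      ((D.continuous_form.comp ((continuous_subtype_val.comp (hc.comp continuous_snd)).prodMk
      (continuous_subtype_val.comp (hd.comp continuous_snd)))).div_const 2))
    (by simp) hφ.2.isCompact
  refine ⟨D.c (g.1 : V →ₗ[F] V) ⁻¹' N₁ ∩ N₂, Filter.inter_mem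
    (hc.tendsto' 0 0 (map_zero _) hN₁) hN₂, fun h hh x y => ?_⟩
  exact D.integrand_add_right g h2 lam (h₁ _ hh.1)
    (fun z hz => h₂ h hh.2 z (subset_tsupport _ hz)) x y

end Weil

end Polarization

end LocalWeil

end

noncomputable section

namespace LocalWeil

theorem exists_end_of_pointwise {A K : Type*} [TopologicalSpace A] [Field K]
    (T : schwartz A K → schwartz A K) (hadd : ∀ φ ψ x, (T (φ + ψ)).1 x = (T φ).1 x + (T ψ).1 x)
    (hsmul : ∀ (a : K) φ x, (T (a • φ)).1 x = a * (T φ).1 x) :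
    ∃ L : Module.End K (schwartz A K), ∀ φ, L φ = T φ :=
  ⟨{ toFun := T
     map_add' := fun φ ψ => Subtype.ext (funext fun x => hadd φ ψ x)
     map_smul' := fun a φ => Subtype.ext (funext fun x => hsmul a φ x) }, fun _ => rfl⟩

namespace Polarization

open Topology

/-! ### The Weil operator preserves Schwartz functions. -/

section Weil

variable {F V : Type*} [Field F] [ValuativeRel F] [TopologicalSpace F]
  [IsNonarchimedeanLocalField F] [AddCommGroup V] [Module F V]
  [TopologicalSpace V] [IsModuleTopology F V] (D : Polarization F V)

/-- The integrand of the Weil operator as a function on `Y_g`. -/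
def weilKernel (lam : AddChar F Circle) (g : D.Sp) (φ : D.X → ℂ) (x : D.X) :
    D.YQuot (g.1 : V →ₗ[F] V) → ℂ :=
  Quotient.lift (D.integrand lam g.1 φ x) (D.integrand_congr lam g φ x)

theorem weilKernel_mk (lam : AddChar F Circle) (g : D.Sp) (φ : D.X → ℂ) (x : D.X) (y : D.Y) :
    D.weilKernel lam g φ x (Submodule.Quotient.mk y) = D.integrand lam g.1 φ x y := rfl

variable (g : D.Sp) {lam : AddChar F Circle} (hlam : Continuous lam) {φ : D.X → ℂ}
  (hφ : φ ∈ schwartz D.X ℂ)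

include hlam hφ in
-- Local constancy descends along the quotient map of `Y`. The block `c` embeds `Y_g` in `X` with a
-- linear left inverse `r`, so the support lies in the compact set `r(supp φ - xa)`.
theorem weilKernel_mem_schwartz (x : D.X) :
    D.weilKernel lam g φ x ∈ schwartz (D.YQuot (g.1 : V →ₗ[F] V)) ℂ := by
  have := IsModuleTopology.topologicalAddGroup F D.X
  have := IsModuleTopology.topologicalAddGroup F D.Y
  have := IsModuleTopology.topologicalAddGroup F (D.YQuot (g.1 : V →ₗ[F] V))
  have hc : Continuous (D.c (g.1 : V →ₗ[F] V)) := continuous_linearMap _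
  have hd : Continuous (D.d (g.1 : V →ₗ[F] V)) := continuous_linearMap _
  constructor
  · have h1 : IsLocallyConstant (D.integrand lam g.1 φ x) := by
      have hform : ∀ {f f' : D.Y → V}, Continuous f → Continuous f' →
          Continuous fun y => D.form (f y) (f' y) := fun hf hf' =>
        D.continuous_form.comp (hf.prodMk hf')
      have hQ : Continuous fun y : D.Y =>
          (D.form (D.a (g.1 : V →ₗ[F] V) x) (D.b (g.1 : V →ₗ[F] V) x)
            - 2 * D.form (D.b (g.1 : V →ₗ[F] V) x) (D.c (g.1 : V →ₗ[F] V) y)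
            + D.form (D.c (g.1 : V →ₗ[F] V) y) (D.d (g.1 : V →ₗ[F] V) y)) / 2 := by
        refine Continuous.div_const (Continuous.add (Continuous.sub continuous_const
          (continuous_const.mul (hform continuous_const ?_))) (hform ?_ ?_)) 2
        · exact continuous_subtype_val.comp hc
        · exact continuous_subtype_val.comp hc
        · exact continuous_subtype_val.comp hd
      exact ((isLocallyConstant_comp (isLocallyConstant_addChar hlam) hQ).comp fun z : Circle => (z : ℂ)).mul
        (isLocallyConstant_comp hφ.1 (continuous_const.add hc))
    intro s
    exact (Submodule.isOpenQuotientMap_mkQ _).isQuotientMap.isOpen_preimage.1 (h1 s)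
  · let cbar := (LinearMap.ker (D.c (g.1 : V →ₗ[F] V))).liftQ (D.c (g.1 : V →ₗ[F] V)) le_rfl
    obtain ⟨r, hr⟩ := LinearMap.exists_leftInverse_of_injective cbar
      (Submodule.ker_liftQ_eq_bot _ _ _ le_rfl)
    have hrc : Continuous fun w : D.X => r (w - D.a (g.1 : V →ₗ[F] V) x) :=
      (continuous_linearMap r).comp (continuous_id.sub continuous_const)
    refine HasCompactSupport.intro (hφ.2.isCompact.image hrc) fun z hz => ?_
    obtain ⟨y, rfl⟩ := Submodule.Quotient.mk_surjective _ z
    rw [weilKernel_mk, integrand, image_eq_zero_of_notMem_tsupport (f := φ) fun hy => hz ⟨_, hy, ?_⟩,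
      mul_zero]
    simp only [add_sub_cancel_left]
    exact LinearMap.congr_fun hr (Submodule.Quotient.mk y)

variable [MeasurableSpace F] [BorelSpace F]

theorem weil_eq (lam : AddChar F Circle) (g : D.Sp) (φ : D.X → ℂ) (x : D.X) :
    D.weil lam g φ x = ∫ z, D.weilKernel lam g φ x z ∂(D.mu lam g.1) := rfl

theorem form_sum_x_smul_y (x : D.X) (t : F) (j : Fin D.n) :
    D.form x (t • D.y j : D.Y) = D.x.repr x j * t := by
  have h1 : (x : V) = ∑ i, D.x.repr x i • (D.x i : V) := by
    conv_lhs => rw [← D.x.sum_repr x]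
    simp only [Submodule.coe_sum, Submodule.coe_smul]
  rw [h1]
  simp [LinearMap.sum_apply, D.dual, mul_comm]

variable (hlam1 : lam ≠ 1) (h2 : (2 : F) ≠ 0)

include hlam hφ hlam1 h2

theorem isLocallyConstant_weil : IsLocallyConstant (D.weil lam g φ) := by
  have := IsModuleTopology.topologicalAddGroup F D.X
  obtain ⟨N, hN, h⟩ := D.exists_nhds_integrand_add_left g hlam hφ h2
  rw [IsLocallyConstant.iff_eventually_eq]
  intro x
  have h1 : Filter.Tendsto (fun y => y - x) (𝓝 x) (𝓝 0) := by
    simpa using (continuous_id.sub continuous_const).tendsto (f := fun y : D.X => y - x) x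
  filter_upwards [h1 hN] with x' hx'
  rw [weil_eq, weil_eq]
  congr 1
  funext z
  obtain ⟨y, rfl⟩ := Submodule.Quotient.mk_surjective _ z
  rw [weilKernel_mk, weilKernel_mk, ← h _ hx' x y, add_sub_cancel]

/-- Translating the variable of integration by a small `y₀` multiplies the value at `x` by `lam(-⟨x,
y₀⟩)`. A nonzero value thus forces `lam(⟨x, y₀⟩) = 1`; with `y₀ ∈ e𝒪 y_j` this bounds the
coordinates of `x` by `c/e`, where `c𝒪` is the conductor. -/
theorem hasCompactSupport_weil : HasCompactSupport (D.weil lam g φ) := by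
  have := IsModuleTopology.topologicalAddGroup F D.X
  have := IsModuleTopology.topologicalAddGroup F D.Y
  have := IsModuleTopology.topologicalAddGroup F (D.YQuot (g.1 : V →ₗ[F] V))
  obtain ⟨N, hN, h⟩ := D.exists_nhds_integrand_add_right g hlam hφ h2
  obtain ⟨hinv, -, -⟩ := D.mu_spec hlam hlam1 g
  obtain ⟨c, hc0, hc⟩ := exists_conductor hlam hlam1
  have hkey : ∀ x, D.weil lam g φ x ≠ 0 → ∀ y₀ ∈ N, lam (D.form x y₀) = 1 := by
    intro x hx y₀ hy₀
    have h1 : D.weil lam g φ x = lam (-D.form x y₀) * D.weil lam g φ x := by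
      conv_lhs =>
        rw [weil_eq, ← integral_add_right_eq_self _
          (Submodule.Quotient.mk y₀ : D.YQuot (g.1 : V →ₗ[F] V))]
      rw [weil_eq, ← integral_const_mul]
      congr 1
      funext z
      obtain ⟨y, rfl⟩ := Submodule.Quotient.mk_surjective _ z
      rw [← Submodule.Quotient.mk_add, weilKernel_mk, weilKernel_mk, h y₀ hy₀]
    have h3 : (lam (-D.form x y₀) : ℂ) = 1 :=
      mul_right_cancel₀ hx (by rw [← h1, one_mul])
    have h4 : lam (-D.form x y₀) = 1 := Circle.ext (by simpa using h3)
    rwa [AddChar.map_neg_eq_inv, inv_eq_one] at h4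
  have hcont : ∀ j, Continuous fun t : F => t • D.y j := fun j =>
    continuous_linearMap (LinearMap.toSpanSingleton F D.Y (D.y j))
  have hW : ⋂ j, (fun t : F => t • D.y j) ⁻¹' N ∈ 𝓝 (0 : F) := by
    refine Filter.iInter_mem.2 fun j => (hcont j).tendsto' 0 0 (zero_smul _ _) hN
  obtain ⟨e, he0, he⟩ := exists_lattice_subset hW
  have hB : Continuous (D.x.equivFun.symm : (Fin D.n → F) → D.X) :=
    continuous_linearMap (D.x.equivFun.symm : (Fin D.n → F) →ₗ[F] D.X)
  refine HasCompactSupport.intro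
    ((isCompact_univ_pi fun _ => isCompact_lattice (c / e)).image hB) fun x hx => ?_
  by_contra hx0
  refine hx ⟨D.x.equivFun x, fun j _ => ?_, D.x.equivFun.symm_apply_apply x⟩
  have h5 : D.x.repr x j * e ∈ lattice c := (hc _).2 fun t ht => by
    have h6 : e * t ∈ lattice e := by
      simpa using mul_mem_lattice (c := e) (mem_lattice.2 le_rfl) ht
    have h7 := hkey x hx0 _ (Set.mem_iInter.1 (he h6) j)
    rwa [form_sum_x_smul_y, ← mul_assoc] at h7
  rw [SetLike.mem_coe, mem_lattice, map_div₀, le_div_iff₀ (zero_lt_iff.2 (by simpa using he0)),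
    ← map_mul]
  exact h5

theorem weil_mem_schwartz : D.weil lam g φ ∈ schwartz D.X ℂ :=
  ⟨D.isLocallyConstant_weil g hlam hφ hlam1 h2, D.hasCompactSupport_weil g hlam hφ hlam1 h2⟩

omit h2 in
theorem integrable_weilKernel (x : D.X) :
    Integrable (D.weilKernel lam g φ x) (D.mu lam g.1) := by
  obtain ⟨h1, h3⟩ := D.weilKernel_mem_schwartz g hlam hφ x
  obtain ⟨-, hfin, -⟩ := D.mu_spec hlam hlam1 g
  obtain ⟨S, -, hS⟩ := integral_comp_eq_sum (D.mu lam g.1) hfin h1 h3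
  exact (hS id rfl).1

end Weil

/-! ### Descent of the Weil operator to a subfield of `ℂ`. -/

section Rationality

variable {F V : Type*} [Field F] [ValuativeRel F] [TopologicalSpace F]
  [IsNonarchimedeanLocalField F] [AddCommGroup V] [Module F V]
  [TopologicalSpace V] [IsModuleTopology F V] [MeasurableSpace F] [BorelSpace F]
  (D : Polarization F V) (g : D.Sp) {lam : AddChar F Circle} (hlam : Continuous lam)
  (hlam1 : lam ≠ 1) (h2 : (2 : F) ≠ 0) {K : IntermediateField ℚ ℂ}

omit [TopologicalSpace V] [ValuativeRel F] [IsNonarchimedeanLocalField F] [IsModuleTopology F V]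
  [MeasurableSpace F] [BorelSpace F] [TopologicalSpace F] in
theorem integrand_mem (hK : ∀ x, (lam x : ℂ) ∈ K) {φ : D.X → ℂ} (hφ : ∀ x, φ x ∈ K)
    (x : D.X) (y : D.Y) : D.integrand lam g.1 φ x y ∈ K := mul_mem (hK _) (hφ _)

theorem toComplex_mem_schwartz {A : Type*} [TopologicalSpace A] (φ : schwartz A K) :
    toComplex φ ∈ schwartz A ℂ :=
  ⟨φ.2.1.comp fun z : K => (z : ℂ), φ.2.2.comp_left (g := fun z : K => (z : ℂ)) rfl⟩

include hlam in
/-- The integrand of the Weil operator for a `K`-valued function, as a `K`-valued function. -/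
theorem exists_weilKernel (hK : ∀ x, (lam x : ℂ) ∈ K) (φ : schwartz D.X K) (x : D.X) :
    ∃ f : schwartz (D.YQuot (g.1 : V →ₗ[F] V)) K,
      toComplex f = D.weilKernel lam g (toComplex φ) x := by
  have hmem : ∀ z, D.weilKernel lam g (toComplex φ) x z ∈ K := by
    intro z
    obtain ⟨y, rfl⟩ := Submodule.Quotient.mk_surjective _ z
    exact D.integrand_mem g hK (fun x => (φ.1 x).2) x y
  obtain ⟨h1, h3⟩ := D.weilKernel_mem_schwartz g hlam (toComplex_mem_schwartz φ) x
  refine ⟨⟨fun z => ⟨_, hmem z⟩, ?_, ?_⟩, rfl⟩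
  · exact IsLocallyConstant.desc _ (fun z : K => (z : ℂ)) h1 Subtype.val_injective
  · refine h3.mono fun z hz => ?_
    rw [Function.mem_support] at hz ⊢
    exact fun h => hz (Subtype.ext h)

include hlam hlam1

/-- The weights are the measures of the fibres of `f`. They do not depend on `ψ`, so the choices `ψ
= id` and `ψ = σ` give two integrals with the same weights, and lying in `ℚ(√q)` they are fixed by
`σ`. -/
theorem integral_spec (hq : ((√(resCard F : ℝ) : ℝ) : ℂ) ∈ K) (f : schwartz (D.YQuot (g.1 : V →ₗ[F] V)) K) :
    ∃ (S : Finset K) (w : K → K), (∀ v, (w v : ℂ) ∈ IntermediateField.adjoin ℚ {((√(resCard F : ℝ) : ℝ) : ℂ)}) ∧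
      ∀ ψ : K → K, ψ 0 = 0 →
        ∫ z, (ψ (f.1 z) : ℂ) ∂(D.mu lam g.1) = (∑ v ∈ S, w v * ψ v : K) := by
  classical
  obtain ⟨-, hfin, hmem⟩ := D.mu_spec hlam hlam1 g
  obtain ⟨S, hS, hint⟩ := integral_comp_eq_sum (D.mu lam g.1) hfin f.2.1 f.2.2
  refine ⟨S, fun v => if h : v ∈ S then
    ⟨((D.mu lam g.1).real (f.1 ⁻¹' {v}) : ℂ), hmem K hq _ (hS v h).1 (hS v h).2⟩ else 0, ?_, ?_⟩
  · intro v
    dsimp only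
    split_ifs with h
    · exact hmem _ (IntermediateField.mem_adjoin_simple_self ℚ _) _ (hS v h).1 (hS v h).2
    · exact IntermediateField.zero_mem _
  · intro ψ hψ
    rw [(hint (fun v => (ψ v : ℂ)) (by rw [hψ]; rfl)).2]
    have h5 : ∀ (S' : Finset K) (a : K → K), ((∑ v ∈ S', a v : K) : ℂ) = ∑ v ∈ S', (a v : ℂ) :=
      fun S' a => map_sum K.val a S'
    rw [h5]
    refine Finset.sum_congr rfl fun v hv => ?_
    simp only [dif_pos hv]
    rfl

include h2

/-- The Weil operator preserves the `K`-valued functions when `K` contains the values of the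
character and `√q`. -/
theorem exists_weilEnd (hK : ∀ x, (lam x : ℂ) ∈ K) (hq : ((√(resCard F : ℝ) : ℝ) : ℂ) ∈ K) :
    ∃ T : Module.End K (schwartz D.X K), ∀ φ, toComplex (T φ) = D.weil lam g (toComplex φ) := by
  have hex : ∀ φ : schwartz D.X K, ∃ ψ : schwartz D.X K, toComplex ψ = D.weil lam g (toComplex φ) := by
    intro φ
    have hmem : ∀ x, D.weil lam g (toComplex φ) x ∈ K := by
      intro x
      obtain ⟨f, hf⟩ := D.exists_weilKernel g hlam hK φ x
      obtain ⟨S, w, -, hw⟩ := D.integral_spec g hlam hlam1 hq f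
      rw [weil_eq, ← hf]
      exact (hw id rfl).symm ▸ Subtype.property _
    obtain ⟨h1, h3⟩ := D.weil_mem_schwartz g hlam (toComplex_mem_schwartz φ) hlam1 h2
    refine ⟨⟨fun z => ⟨_, hmem z⟩, ?_, ?_⟩, rfl⟩
    · exact IsLocallyConstant.desc _ (fun z : K => (z : ℂ)) h1 Subtype.val_injective
    · refine h3.mono fun z hz => ?_
      rw [Function.mem_support] at hz ⊢
      exact fun h => hz (Subtype.ext h)
  choose T hT using hex
  have hT' : ∀ φ x, ((T φ).1 x : ℂ) = ∫ z, D.weilKernel lam g (toComplex φ) x z ∂(D.mu lam g.1) :=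
    fun φ x => congrFun (hT φ) x
  obtain ⟨L, hL⟩ := exists_end_of_pointwise T
    (fun φ ψ x => Subtype.ext (by
      rw [IntermediateField.coe_add, hT', hT', hT', ← integral_add
        (D.integrable_weilKernel g hlam (toComplex_mem_schwartz φ) hlam1 x)
        (D.integrable_weilKernel g hlam (toComplex_mem_schwartz ψ) hlam1 x)]
      congr 1
      funext z
      obtain ⟨y, rfl⟩ := Submodule.Quotient.mk_surjective _ z
      exact mul_add _ _ _))
    (fun a φ x => Subtype.ext (by
      rw [IntermediateField.coe_mul, hT', hT', ← integral_const_mul]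
      congr 1
      funext z
      obtain ⟨y, rfl⟩ := Submodule.Quotient.mk_surjective _ z
      exact mul_left_comm _ _ _))
  exact ⟨L, fun φ => by rw [hL, hT]⟩

end Rationality

end Polarization

end LocalWeil

end

noncomputable section

namespace LocalWeil

/-! ### The field `E` and the Galois conjugate of the Weil operator. -/

theorem coe_mem_fieldE {F : Type*} [Field F] (lam : AddChar F Circle) (x : F) :
    (lam x : ℂ) ∈ fieldE lam := charField_le_fieldE lam (coe_mem_charField lam x)

theorem I_mem_fieldE {F : Type*} [Field F] (lam : AddChar F Circle) : Complex.I ∈ fieldE lam :=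
  (le_sup_right : _ ≤ fieldE lam) (IntermediateField.mem_adjoin_simple_self ℚ _)

theorem rescale_ne_one {F : Type*} [Field F] {lam : AddChar F Circle} (hlam1 : lam ≠ 1) {s : F}
    (hs : s ≠ 0) : rescale lam s ≠ 1 := by
  intro h
  refine hlam1 (DFunLike.ext _ _ fun x => ?_)
  have h1 := DFunLike.congr_fun h (s⁻¹ * x)
  rwa [rescale, AddChar.mulShift_apply, mul_inv_cancel_left₀ hs] at h1

end LocalWeil

end

theorem proposition12
    {F : Type*} [Field F] [ValuativeRel F] [TopologicalSpace F] [IsNonarchimedeanLocalField F]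
    [MeasurableSpace F] [BorelSpace F] (hp : LocalWeil.resChar F ≠ 2)
    {V : Type*} [AddCommGroup V] [Module F V] [TopologicalSpace V] [IsModuleTopology F V]
    (D : LocalWeil.Polarization F V)
    (lam : AddChar F Circle) (hlam : Continuous lam) (hlam1 : lam ≠ 1)
    (σ : LocalWeil.fieldE lam ≃ₐ[ℚ] LocalWeil.fieldE lam)
    (hσq : ∀ z : LocalWeil.fieldE lam,
      (z : ℂ) ∈ IntermediateField.adjoin ℚ {((√(LocalWeil.resCard F : ℝ) : ℝ) : ℂ)} → σ z = z)
    (s : (LocalWeil.primeClosure F)ˣ)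
    (σs : LocalWeil.charField lam ≃ₐ[ℚ] LocalWeil.charField lam)
    (hσs : LocalWeil.IsSigma lam s σs)
    (hσ : ∀ z : LocalWeil.charField lam,
      σ (IntermediateField.inclusion (LocalWeil.charField_le_fieldE lam) z) =
        IntermediateField.inclusion (LocalWeil.charField_le_fieldE lam) (σs z))
    (g : D.Sp) :
    ∃ T T' : Module.End (LocalWeil.fieldE lam) (LocalWeil.schwartz D.X (LocalWeil.fieldE lam)),
      (∀ φ, LocalWeil.toComplex (T φ) = D.weil lam g (LocalWeil.toComplex φ)) ∧
      (∀ φ, LocalWeil.toComplex (T' φ) =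
        D.weil (LocalWeil.rescale lam ((s : LocalWeil.primeClosure F) : F)) g
          (LocalWeil.toComplex φ)) ∧
      LocalWeil.galConj σ T = T' := by
  set t : F := ((s : LocalWeil.primeClosure F) : F) with ht
  have ht1 : valuation F t = 1 := LocalWeil.valuation_primeClosure_unit s
  have ht0 : t ≠ 0 := by
    intro h
    rw [h, map_zero] at ht1
    exact zero_ne_one ht1
  have h2 := LocalWeil.Polarization.two_ne_zero_of_resChar_ne_two hp
  have hK := LocalWeil.coe_mem_fieldE lam
  have hq := LocalWeil.sqrt_resCard_mem hp hlam hlam1 hK (LocalWeil.I_mem_fieldE lam)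
  have hlam' : Continuous (LocalWeil.rescale lam t) := hlam.comp (continuous_const_mul t)
  have hK' : ∀ x, (LocalWeil.rescale lam t x : ℂ) ∈ LocalWeil.fieldE lam := fun x => hK (t * x)
  obtain ⟨T, hT⟩ := D.exists_weilEnd g hlam hlam1 h2 hK hq
  obtain ⟨T', hT'⟩ := D.exists_weilEnd g hlam' (LocalWeil.rescale_ne_one hlam1 ht0) h2 hK' hq
  refine ⟨T, T', hT, hT', LinearMap.ext fun φ => Subtype.ext (funext fun x => Subtype.ext ?_)⟩
  have hσlam : ∀ u : F, σ ⟨(lam u : ℂ), hK u⟩ = ⟨(LocalWeil.rescale lam t u : ℂ), hK' u⟩ := by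
    intro u
    have h0 : IntermediateField.inclusion (LocalWeil.charField_le_fieldE lam)
        ⟨(lam u : ℂ), LocalWeil.coe_mem_charField lam u⟩ = ⟨(lam u : ℂ), hK u⟩ :=
      Subtype.ext (IntermediateField.coe_inclusion _ _)
    rw [← h0, hσ]
    refine Subtype.ext ((IntermediateField.coe_inclusion _ _).trans ?_)
    rw [hσs.apply_coe hlam u]
    rfl
  let ψ := LocalWeil.galAct σ.symm φ
  obtain ⟨f, hf⟩ := D.exists_weilKernel g hlam hK ψ x
  obtain ⟨f', hf'⟩ := D.exists_weilKernel g hlam' hK' φ x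
  -- The two integrands on `Y_g` are conjugate under `σ`: at `y` they have the same phase argument
  -- `u` and evaluate `σ⁻¹φ` and `φ` at the same point `w`.
  have hff' : ∀ z, f'.1 z = σ (f.1 z) := by
    intro z
    obtain ⟨y, rfl⟩ := Submodule.Quotient.mk_surjective _ z
    obtain ⟨u, w, hu, hu'⟩ : ∃ (u : F) (w : D.X),
        f.1 (Submodule.Quotient.mk y) = ⟨(lam u : ℂ), hK u⟩ * ψ.1 w ∧
        f'.1 (Submodule.Quotient.mk y) = ⟨(LocalWeil.rescale lam t u : ℂ), hK' u⟩ * φ.1 w :=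
      ⟨_, _, Subtype.ext (congrFun hf (Submodule.Quotient.mk y)),
        Subtype.ext (congrFun hf' (Submodule.Quotient.mk y))⟩
    rw [hu, hu', map_mul, hσlam]
    exact congrArg _ (σ.apply_symm_apply (φ.1 w)).symm
  obtain ⟨S, w, hw, hint⟩ := D.integral_spec g hlam hlam1 hq f
  have h3 : (T ψ).1 x = ∑ v ∈ S, w v * v := by
    refine Subtype.ext ((congrFun (hT ψ) x).trans ?_)
    rw [D.weil_eq, ← hf]
    exact hint id rfl
  have h4 : (T' φ).1 x = ∑ v ∈ S, w v * σ v := by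
    refine Subtype.ext ((congrFun (hT' φ) x).trans ?_)
    -- Since the measures for `λ[s]` and `λ` coincide, the integral of `f' = σ ∘ f` uses the weights
    -- already found for `f`.
    rw [D.weil_eq, ← hf', D.mu_congr g (LocalWeil.selfDual_rescale lam ht1), ← hint σ (map_zero σ)]
    congr 1
    funext z
    exact congrArg Subtype.val (hff' z)
  have h5 : (LocalWeil.galConj σ T φ).1 x = σ ((T ψ).1 x) := rfl
  rw [h5, h3, h4, map_sum]
  refine congrArg _ (Finset.sum_congr rfl fun v _ => ?_)
  rw [map_mul, hσq (w v) (hw v)]
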